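/- A \emph{tree} is a poset $\tau=(T,\succ)$ in which, for every $t\in T$, the set of ancestors $\{s\in T: s\succ t\}$ is well-ordered by $\succ$. A child of $x$ is an element $y$ with $x\succ y$ and no $z$ with $x\succ z\succ y$; the maximum degree $d(\tau)$ is the maximum of the number of maximal elements of $\tau$ and of the numbers of children of the elements of $\tau$. A \emph{comparison query} $(i,j)$ to the oracle of $\tau$ takes one step and tells whether $i\succ j$, $j\succ i$, or neither. To \emph{sort} $\tau$ means to construct, from the number $n$ of elements (which are labelled $0,\dots,n-1$) and the comparison oracle, a data structure from which every comparison query can afterwards be answered correctly in $O(1)$ time without the oracle. Theorem. There is a randomized algorithm (one fixed program of a randomized random access machine with unit cost per instruction, which is given $n$ and the oracle, but not $d$) that sorts every tree $\tau$ on $n$ elements: it halts in finite expected time, and the data structure with which it halts is always correct. Moreover there is a constant $C$ such that for every $n\ge 2$ and every tree $\tau$ on $n$ elements with maximum degree $d=d(\tau)$, both the expected number of oracle queries and the expected running time are at most $C\,d\,n\log n$. -/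

import Mathlib

namespace TreeSort

/-! ### Tree posets -/

section Order

variable {T : Type*}

/-- `r a b` reads `a ≻ b` (`a` dominates `b`). A tree is a poset (given by its strict relation) in
which the set of ancestors of every element is well-ordered by `≻`. -/
structure IsTree (r : T → T → Prop) : Prop where
  strictOrder : IsStrictOrder T r
  wellOrdered : ∀ t : T, IsWellOrder {s : T // r s t} (fun a b => r a.1 b.1)

/-- The set of maximal elements (roots). -/
def maximals (r : T → T → Prop) : Set T := {x | ∀ y, ¬ r y x}

/-- The set of children of `x`. -/
def children (r : T → T → Prop) (x : T) : Set T := {y | r x y ∧ ∀ z, ¬ (r x z ∧ r z y)}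

/-- The maximum degree `d`: the maximum of the number of roots and of the numbers of children. -/
noncomputable def maxDegree [Fintype T] (r : T → T → Prop) : ℕ :=
  max (maximals r).ncard (Finset.univ.sup fun t => (children r t).ncard)

end Order

open Classical in
/-- The comparison oracle of a relation on the elements `0, …, n - 1`: the answer to the query
`(i, j)` is `1` for `i ≻ j`, `2` for `j ≻ i` and `0` otherwise. A query that does not name two
elements is answered `0`. -/
noncomputable def oracle {n : ℕ} (r : Fin n → Fin n → Prop) (i j : ℕ) : ℕ :=
  if h : i < n ∧ j < n then
    if r ⟨i, h.1⟩ ⟨j, h.2⟩ then 1 else if r ⟨j, h.2⟩ ⟨i, h.1⟩ then 2 else 0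
  else 0

/-! ### Randomized random access machines with an oracle

A program is a finite text. It works on registers and on arrays, all of whose cells hold natural
numbers; arrays are accessed at an index that is held in a register. Every instruction and every
evaluation of a test is one step. The only instruction that can produce a number larger than all
the numbers present so far (and the literals of the program) is the successor, so on input `n` all
numbers are at most `n + t + const` after `t` steps, and unit cost per instruction is the usual
measure for words of logarithmic length. -/

/-- The memory: registers `reg x` and arrays `arr a` with cells `arr a i`. -/
structure Mem where
  reg : ℕ → ℕ
  arr : ℕ → ℕ → ℕ

/-- Write `v` to the register `x`. -/
def Mem.setReg (m : Mem) (x v : ℕ) : Mem :=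
  { m with reg := Function.update m.reg x v }

/-- Write `v` to the cell `i` of the array `a`. -/
def Mem.setArr (m : Mem) (a i v : ℕ) : Mem :=
  { m with arr := Function.update m.arr a (Function.update (m.arr a) i v) }

/-- Tests: compare the contents of two registers. -/
inductive Test where
  | lt (x y : ℕ)
  | eq (x y : ℕ)

/-- The truth value of a test. -/
def Test.eval (m : Mem) : Test → Bool
  | .lt x y => decide (m.reg x < m.reg y)
  | .eq x y => decide (m.reg x = m.reg y)

/-- Programs. The arguments `x y z i j` are names of registers, `a` is the name of an array and
`c` is a literal. -/
inductive Cmd where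
  /-- do nothing -/
  | skip
  /-- `x := c` -/
  | const (x c : ℕ)
  /-- `x := y` -/
  | copy (x y : ℕ)
  /-- `x := y + 1` -/
  | succ (x y : ℕ)
  /-- `x := y - z`, or `0` if this is negative -/
  | sub (x y z : ℕ)
  /-- `x := ⌊(y + z) / 2⌋` -/
  | mid (x y z : ℕ)
  /-- `x := ⌊y / z⌋`, or `0` if `z` is `0` -/
  | div (x y z : ℕ)
  /-- `x := a[i]` -/
  | load (x a i : ℕ)
  /-- `a[i] := x` -/
  | store (a i x : ℕ)
  /-- `x :=` the oracle's answer to the query `(i, j)` -/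
  | query (x i j : ℕ)
  /-- `x :=` a uniformly random element of `{0, …, y}`, independent of everything before -/
  | rand (x y : ℕ)
  | seq (p q : Cmd)
  | ite (b : Test) (p q : Cmd)
  | while (b : Test) (p : Cmd)

/-- A configuration: the programs still to be executed, one after the other, and the memory.
The machine has halted when nothing is left to be executed. -/
abbrev Config := List Cmd × Mem

/-- The halted configurations. -/
def Config.Halted (c : Config) : Prop := c.1 = []

/-- The configurations whose next step is a query to the oracle. -/
def Config.AtQuery (c : Config) : Prop := ∃ x i j k, c.1 = Cmd.query x i j :: k

/-- One step of the machine with the oracle `O`; halted configurations stay as they are. -/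
noncomputable def step (O : ℕ → ℕ → ℕ) : Config → PMF Config
  | ([], m) => PMF.pure ([], m)
  | (.skip :: k, m) => PMF.pure (k, m)
  | (.const x c :: k, m) => PMF.pure (k, m.setReg x c)
  | (.copy x y :: k, m) => PMF.pure (k, m.setReg x (m.reg y))
  | (.succ x y :: k, m) => PMF.pure (k, m.setReg x (m.reg y + 1))
  | (.sub x y z :: k, m) => PMF.pure (k, m.setReg x (m.reg y - m.reg z))
  | (.mid x y z :: k, m) => PMF.pure (k, m.setReg x ((m.reg y + m.reg z) / 2))
  | (.div x y z :: k, m) => PMF.pure (k, m.setReg x (m.reg y / m.reg z))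
  | (.load x a i :: k, m) => PMF.pure (k, m.setReg x (m.arr a (m.reg i)))
  | (.store a i x :: k, m) => PMF.pure (k, m.setArr a (m.reg i) (m.reg x))
  | (.query x i j :: k, m) => PMF.pure (k, m.setReg x (O (m.reg i) (m.reg j)))
  | (.rand x y :: k, m) =>
      (PMF.uniformOfFintype (Fin (m.reg y + 1))).map fun v => (k, m.setReg x v)
  | (.seq p q :: k, m) => PMF.pure (p :: q :: k, m)
  | (.ite b p q :: k, m) => PMF.pure (if b.eval m then (p :: k, m) else (q :: k, m))
  | (.while b p :: k, m) => PMF.pure (if b.eval m then (p :: .while b p :: k, m) else (k, m))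

/-- The distribution of the configuration after `t` steps from the configuration `c`. -/
noncomputable def run (O : ℕ → ℕ → ℕ) : ℕ → Config → PMF Config
  | 0, c => PMF.pure c
  | t + 1, c => (step O c).bind (run O t)

/-- The expected number of steps before halting: the sum over `t` of the probability that the
machine has not halted after `t` steps. It is infinite unless the machine halts almost surely. -/
noncomputable def expectedTime (O : ℕ → ℕ → ℕ) (c : Config) : ENNReal :=
  ∑' t, (run O t c).toOuterMeasure {c' | ¬ c'.Halted}

/-- The expected number of queries: the sum over `t` of the probability that the step after the
first `t` ones is a query. -/
noncomputable def expectedQueries (O : ℕ → ℕ → ℕ) (c : Config) : ENNReal :=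
  ∑' t, (run O t c).toOuterMeasure {c' | c'.AtQuery}

/-- The program contains no query to the oracle. -/
def Cmd.OracleFree : Cmd → Prop
  | .query _ _ _ => False
  | .seq p q => p.OracleFree ∧ q.OracleFree
  | .ite _ p q => p.OracleFree ∧ q.OracleFree
  | .while _ p => p.OracleFree
  | _ => True

/-! ### The sorting problem -/

/-- The start of the sorting program `P` on `n` elements: the register `0` holds `n`, everything
else is `0`. -/
def startConfig (P : Cmd) (n : ℕ) : Config :=
  ([P], { reg := fun x => if x = 0 then n else 0, arr := fun _ _ => 0 })

/-- The start of the answering program `Q` on the pair `(i, j)` in the memory `m`: the registers `0`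
and `1` are set to `i` and `j`. -/
def answerConfig (Q : Cmd) (m : Mem) (i j : ℕ) : Config :=
  ([Q], (m.setReg 0 i).setReg 1 j)

/-- The memory `m` holds a data structure for the relation `r`: from it, and without any oracle
(the one supplied always answers `0`), the program `Q` halts within `K` steps on every pair of
elements and leaves in the register `0` the correct answer to the comparison of this pair. -/
def Represents {n : ℕ} (r : Fin n → Fin n → Prop) (Q : Cmd) (K : ℕ) (m : Mem) : Prop :=
  ∀ i j : Fin n, ∀ c ∈ (run (fun _ _ => 0) K (answerConfig Q m i j)).support,
    c.Halted ∧ c.2.reg 0 = oracle r i j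

/-- The sorting program `P`, run with the comparison oracle of `r`, halts in finite expected time
(in particular almost surely), and whenever it halts, its memory holds a data structure for `r` from
which `Q` answers comparisons within `K` steps. -/
def Sorts {n : ℕ} (r : Fin n → Fin n → Prop) (P Q : Cmd) (K : ℕ) : Prop :=
  expectedTime (oracle r) (startConfig P n) < ⊤ ∧
  ∀ t : ℕ, ∀ c ∈ (run (oracle r) t (startConfig P n)).support, c.Halted → Represents r Q K c.2

end TreeSort

namespace TreeSort

/-! ### Expected cost with a final reward -/

/-! The algorithm is a quicksort for forests. The elements sit in an array that is divided into
segments. The elements of a segment share a provisional parent `p`, and their ancestors are those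
inside the segment together with `p` and everything above `p` (`Closed`). One round picks two
uniform, independent elements `x`, `y` of the first unsettled segment `S`. If `x ≽ y`, nothing
happens. Otherwise let `z` be the highest element of `S` with `z ≽ x` and not `z ≽ y`. One scan
finds `z`, a second one finds its lowest ancestor in `S`, and a third one moves the elements below
`z` to the end of the segment and gives them that ancestor as provisional parent. Both parts are
again closed (`segs_cut`), and ancestors never end up behind the part that contains their
descendants. In a segment of length one the provisional parent is the true one.

The heart is `random_cut`: the smaller part of a random cut has expected size at least `|S| / (256
d)`. If some subtree contains more than half of `S`, take the smallest such one. Either many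
elements lie outside of it, and then cuts with `x` inside and `y` outside are balanced enough on
average (`outside_count`); or nearly everything lies in it, and then cuts tend to separate one of at
most `d` subtrees hanging from its root, whose sizes are controlled by Cauchy–Schwarz
(`inside_count`). If there is no such subtree, the second argument applies to the at most `d` trees
of `S`. The degree enters only this analysis; the program does not know it.

Splitting `m` into `k` and `m - k` lowers the sum of the `t log t` by at least half of the smaller
part (`xlog_split`). So a multiple of `d` times this sum is a potential whose expected drop pays for
the linear cost of a round (`iteration_cost`), while the potential is `O(d n log n)` at the start.

Once all parents are known, two linear passes assign nested intervals to the elements, and `u ≻ v`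
holds exactly if the left end for `v` lies strictly inside the interval of `u`
(`Intervals.correct`). This answers comparisons in constant time.

Running time and correctness are treated together: `cost` adds to the expected time a reward for the
final memory. With reward `⊤` on wrong memories and `0` on right ones, one finite bound gives the
expected time and excludes wrong answers (`reward_ne_top`). Queries are steps, so the time bound
also bounds their number. -/

/-- The expected number of steps plus the expected reward `φ` of the final memory, where only the
first `N` steps are taken into account. -/
noncomputable def cost (O : ℕ → ℕ → ℕ) (φ : Mem → ENNReal) : ℕ → Config → ENNReal
  | 0, _ => 0
  | N + 1, c =>
      open Classical in if c.1 = [] then φ c.2 else 1 + ∑' c', step O c c' * cost O φ N c'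

variable {O : ℕ → ℕ → ℕ} {φ : Mem → ENNReal}

theorem cost_mono_succ (N : ℕ) : ∀ c, cost O φ N c ≤ cost O φ (N + 1) c := by
  induction N with
  | zero => intro c; simp [cost]
  | succ N ih =>
    intro c
    rw [cost, cost]
    split_ifs with h
    · exact le_rfl
    · gcongr with c'
      exact ih c'

theorem step_halted (m : Mem) : step O ([], m) = PMF.pure ([], m) := by simp [step]

theorem run_halted (m : Mem) (t : ℕ) : run O t ([], m) = PMF.pure ([], m) := by
  induction t with
  | zero => rfl
  | succ t ih => rw [run, step_halted, PMF.pure_bind, ih]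

theorem cost_cons (N : ℕ) (p : Cmd) (k : List Cmd) (m : Mem) :
    cost O φ (N + 1) (p :: k, m) = 1 + ∑' c', step O (p :: k, m) c' * cost O φ N c' := by
  simp [cost]

/-- Each step that starts in a non-halted configuration is charged 1 by `cost`; the remaining
contribution, the reward, is nonnegative and is dropped. -/
theorem sum_prob_le_cost (N : ℕ) : ∀ c : Config,
    ∑ t ∈ Finset.range N, (run O t c).toOuterMeasure {c' | ¬ c'.Halted} ≤ cost O φ N c := by
  induction N with
  | zero => intro c; simp
  | succ N ih =>
    rintro ⟨k, m⟩
    cases k with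
    | nil =>
      have h : ∀ t, (run O t (([], m) : Config)).toOuterMeasure {c' | ¬ c'.Halted} = 0 := by
        intro t
        rw [run_halted, PMF.toOuterMeasure_pure_apply]
        simp [Config.Halted]
      simp [h]
    | cons p k =>
      rw [cost_cons, Finset.sum_range_succ']
      have h0 : (run O 0 (p :: k, m)).toOuterMeasure {c' | ¬ c'.Halted} = 1 := by
        rw [run, PMF.toOuterMeasure_pure_apply]
        simp [Config.Halted]
      rw [h0, add_comm]
      gcongr
      simp only [run, PMF.toOuterMeasure_bind_apply]
      rw [← Summable.tsum_finsetSum (fun _ _ => ENNReal.summable)]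
      refine ENNReal.tsum_le_tsum fun c' => ?_
      rw [← Finset.mul_sum]
      gcongr
      exact ih c'

theorem expectedTime_le {c : Config} {B : ENNReal} (h : ∀ N, cost O φ N c ≤ B) :
    expectedTime O c ≤ B := by
  rw [expectedTime, ENNReal.tsum_eq_iSup_nat]
  exact iSup_le fun N => (sum_prob_le_cost N c).trans (h N)

theorem expectedQueries_le_expectedTime (c : Config) :
    expectedQueries O c ≤ expectedTime O c := by
  refine ENNReal.tsum_le_tsum fun t => MeasureTheory.OuterMeasure.mono _ ?_
  rintro c' ⟨x, i, j, k, hk⟩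
  simp [Config.Halted, hk]

/-- A halted configuration in the support has positive probability, and a positive number times `⊤`
is `⊤`. Hence a finite cost bound, for a reward that is `⊤` on incorrect memories, proves that every
possible output is correct, not just almost every one. -/
theorem reward_ne_top (t : ℕ) : ∀ c : Config, cost O φ (t + 1) c ≠ ⊤ →
    ∀ c' ∈ (run O t c).support, c'.Halted → φ c'.2 ≠ ⊤ := by
  induction t with
  | zero =>
    intro c hc c' hc' hh
    rw [run, PMF.support_pure, Set.mem_singleton_iff] at hc'
    subst hc'
    rwa [cost, if_pos (show c'.1 = [] from hh)] at hc
  | succ t ih =>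
    rintro ⟨k, m⟩ hc c' hc' hh
    cases k with
    | nil =>
      rw [run_halted, PMF.support_pure, Set.mem_singleton_iff] at hc'
      subst hc'
      rw [cost, if_pos rfl] at hc
      exact hc
    | cons p k =>
      rw [run, PMF.mem_support_bind_iff] at hc'
      obtain ⟨c1, h1, h2⟩ := hc'
      refine ih c1 (fun htop => hc ?_) c' h2 hh
      rw [cost_cons]
      have h3 : step O (p :: k, m) c1 * cost O φ (t + 1) c1 = ⊤ := by
        rw [htop]
        exact ENNReal.mul_top ((PMF.mem_support_iff _ _).1 h1)
      have h4 := ENNReal.le_tsum (f := fun c' => step O (p :: k, m) c' * cost O φ (t + 1) c') c1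
      rw [h3, top_le_iff] at h4
      rw [h4]
      simp

theorem tsum_pure_mul (c : Config) (g : Config → ENNReal) :
    ∑' c', (PMF.pure c : PMF Config) c' * g c' = g c := by
  rw [tsum_eq_single c]
  · simp
  · intro c' h
    simp [PMF.pure_apply, h]

theorem tsum_map_mul {α β : Type*} (p : PMF α) (f : α → β) (g : β → ENNReal) :
    ∑' b, (p.map f) b * g b = ∑' a, p a * g (f a) := by
  classical
  simp only [PMF.map_apply, ← ENNReal.tsum_mul_right]
  rw [ENNReal.tsum_comm]
  refine tsum_congr fun a => ?_
  rw [tsum_eq_single (f a)]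
  · simp
  · intro b h
    simp [h]

theorem cost_rand_le (N x y : ℕ) (k : List Cmd) (m : Mem) :
    cost O φ N (.rand x y :: k, m) ≤
      1 + ((m.reg y + 1 : ℕ) : ENNReal)⁻¹ *
        ∑ v ∈ Finset.range (m.reg y + 1), cost O φ N (k, m.setReg x v) := by
  cases N with
  | zero => simp [cost]
  | succ N =>
    -- In `step`, the uniform distribution on `Fin` is coerced to a distribution on `ℕ` before it is
    -- mapped to configurations; this identifies the coercion with the map along `Fin.val`.
    have hmap : (do let a ← PMF.uniformOfFintype (Fin (m.reg y + 1)); pure (a : ℕ) : PMF ℕ) =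
        (PMF.uniformOfFintype (Fin (m.reg y + 1))).map Fin.val := rfl
    rw [cost_cons, step, tsum_map_mul, hmap, tsum_map_mul, tsum_fintype, Finset.mul_sum]
    rw [← Fin.sum_univ_eq_sum_range
      (fun v => ((m.reg y + 1 : ℕ) : ENNReal)⁻¹ * cost O φ (N + 1) (k, m.setReg x v))]
    gcongr with v
    · simp
    · exact cost_mono_succ N _

/-! ### Deterministic runs -/

/-- The machine goes in `t` steps, all of them deterministic, from `c` to `c'`. -/
def DetSteps (O : ℕ → ℕ → ℕ) : ℕ → Config → Config → Prop
  | 0, c, c' => c = c'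
  | t + 1, c, c' => ∃ c1, c.1 ≠ [] ∧ step O c = PMF.pure c1 ∧ DetSteps O t c1 c'

/-- The machine goes deterministically in at most `T` steps from `c` to `c'`. -/
def Reaches (O : ℕ → ℕ → ℕ) (T : ℕ) (c c' : Config) : Prop := ∃ t ≤ T, DetSteps O t c c'

theorem DetSteps.trans {t s : ℕ} : ∀ {c c' c'' : Config}, DetSteps O t c c' →
    DetSteps O s c' c'' → DetSteps O (t + s) c c'' := by
  induction t with
  | zero => rintro c c' c'' rfl h; simpa using h
  | succ t ih =>
    rintro c c' c'' ⟨c1, h0, h1, h2⟩ h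
    rw [Nat.succ_add]
    exact ⟨c1, h0, h1, ih h2 h⟩

theorem Reaches.refl (T : ℕ) (c : Config) : Reaches O T c c := ⟨0, Nat.zero_le _, rfl⟩

theorem Reaches.trans {t s : ℕ} {c c' c'' : Config} (h : Reaches O t c c')
    (h' : Reaches O s c' c'') : Reaches O (t + s) c c'' := by
  obtain ⟨a, ha, ha'⟩ := h
  obtain ⟨b, hb, hb'⟩ := h'
  exact ⟨a + b, by omega, ha'.trans hb'⟩

theorem Reaches.mono {t s : ℕ} {c c' : Config} (h : Reaches O t c c') (hts : t ≤ s) :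
    Reaches O s c c' := by
  obtain ⟨a, ha, ha'⟩ := h
  exact ⟨a, ha.trans hts, ha'⟩

theorem Reaches.one {p : Cmd} {k : List Cmd} {m : Mem} {c' : Config}
    (h : step O (p :: k, m) = PMF.pure c') : Reaches O 1 (p :: k, m) c' :=
  ⟨1, le_rfl, c', by simp, h, rfl⟩

theorem Reaches.head {T : ℕ} {p : Cmd} {k : List Cmd} {m : Mem} {c1 c' : Config}
    (h : step O (p :: k, m) = PMF.pure c1) (h' : Reaches O T c1 c') :
    Reaches O (1 + T) (p :: k, m) c' :=
  (Reaches.one h).trans h'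

theorem DetSteps.cost_le {t : ℕ} : ∀ {c c' : Config}, DetSteps O t c c' →
    ∀ N, cost O φ N c ≤ t + cost O φ N c' := by
  induction t with
  | zero => rintro c c' rfl N; simp
  | succ t ih =>
    rintro c c' ⟨c1, h0, h1, h2⟩ N
    cases N with
    | zero => simp [cost]
    | succ N =>
      rw [cost, if_neg h0, h1, tsum_pure_mul]
      calc 1 + cost O φ N c1 ≤ 1 + (t + cost O φ N c') := by gcongr; exact ih h2 N
        _ ≤ 1 + (t + cost O φ (N + 1) c') := by gcongr; exact cost_mono_succ N c'
        _ = _ := by push_cast; ring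

theorem Reaches.cost_le {T : ℕ} {c c' : Config} (h : Reaches O T c c') (N : ℕ) :
    cost O φ N c ≤ T + cost O φ N c' := by
  obtain ⟨t, ht, h⟩ := h
  refine (h.cost_le N).trans ?_
  gcongr

theorem DetSteps.run_eq {t : ℕ} : ∀ {c c' : Config}, DetSteps O t c c' →
    ∀ s, run O (t + s) c = run O s c' := by
  induction t with
  | zero => rintro c c' rfl s; simp
  | succ t ih =>
    rintro c c' ⟨c1, h0, h1, h2⟩ s
    rw [Nat.succ_add, run, h1, PMF.pure_bind, ih h2]

theorem Reaches.run_eq {T : ℕ} {c : Config} {m : Mem} (h : Reaches O T c ([], m)) :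
    run O T c = PMF.pure ([], m) := by
  obtain ⟨t, ht, h⟩ := h
  obtain ⟨s, rfl⟩ := Nat.exists_eq_add_of_le ht
  rw [h.run_eq, run_halted]

/-! ### Loop-free programs -/

/-- The program uses neither loops nor random numbers. -/
def Cmd.LoopFree : Cmd → Prop
  | .rand _ _ => False
  | .while _ _ => False
  | .seq p q => p.LoopFree ∧ q.LoopFree
  | .ite _ p q => p.LoopFree ∧ q.LoopFree
  | _ => True

/-- The memory after the execution of a loop-free program. -/
def Cmd.exec (O : ℕ → ℕ → ℕ) : Cmd → Mem → Mem
  | .skip, m => m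
  | .const x c, m => m.setReg x c
  | .copy x y, m => m.setReg x (m.reg y)
  | .succ x y, m => m.setReg x (m.reg y + 1)
  | .sub x y z, m => m.setReg x (m.reg y - m.reg z)
  | .mid x y z, m => m.setReg x ((m.reg y + m.reg z) / 2)
  | .div x y z, m => m.setReg x (m.reg y / m.reg z)
  | .load x a i, m => m.setReg x (m.arr a (m.reg i))
  | .store a i x, m => m.setArr a (m.reg i) (m.reg x)
  | .query x i j, m => m.setReg x (O (m.reg i) (m.reg j))
  | .rand _ _, m => m
  | .seq p q, m => q.exec O (p.exec O m)
  | .ite b p q, m => if b.eval m then p.exec O m else q.exec O m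
  | .while _ _, m => m

/-- A bound for the number of steps of a loop-free program. -/
def Cmd.weight : Cmd → ℕ
  | .seq p q => 1 + p.weight + q.weight
  | .ite _ p q => 1 + p.weight + q.weight
  | _ => 1

theorem reaches_exec (p : Cmd) : p.LoopFree → ∀ (k : List Cmd) (m : Mem),
    Reaches O p.weight (p :: k, m) (k, p.exec O m) := by
  induction p with
  | seq p q ihp ihq =>
    intro h k m
    have h1 : Reaches O 1 (.seq p q :: k, m) (p :: q :: k, m) := Reaches.one (by simp [step])
    exact (h1.trans (ihp h.1 _ m)).trans (ihq h.2 _ _)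
  | ite b p q ihp ihq =>
    intro h k m
    have h1 : Reaches O 1 (.ite b p q :: k, m) (if b.eval m then (p :: k, m) else (q :: k, m)) :=
      Reaches.one (by simp [step])
    cases hb : b.eval m with
    | true =>
      simp only [hb, if_true] at h1
      simpa [Cmd.exec, hb] using (h1.trans (ihp h.1 k m)).mono (by simp [Cmd.weight])
    | false =>
      simp only [hb] at h1
      simpa [Cmd.exec, hb] using (h1.trans (ihq h.2 k m)).mono
        (by simp only [Cmd.weight]; omega)
  | rand => intro h; exact h.elim
  | _ =>
    first
    | exact fun h => h.elim
    | exact fun _ k m => Reaches.one (by simp [step, Cmd.exec])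

/-- A loop with a loop-free body, with a loop invariant that is indexed by the number of
iterations. -/
theorem while_reaches {b : Test} {p : Cmd} (hp : p.LoopFree) (I : ℕ → Mem → Prop) (L : ℕ)
    (hstep : ∀ j < L, ∀ m, I j m → b.eval m = true ∧ I (j + 1) (p.exec O m))
    (hend : ∀ m, I L m → b.eval m = false) {m : Mem} (hm : I 0 m) :
    ∃ m', I L m' ∧ ∀ k, Reaches O (L * (p.weight + 1) + 1) (.while b p :: k, m) (k, m') := by
  have key : ∀ s j, j + s = L → ∀ m, I j m → ∃ m', I L m' ∧
      ∀ k, Reaches O (s * (p.weight + 1) + 1) (.while b p :: k, m) (k, m') := by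
    intro s
    induction s with
    | zero =>
      intro j hj m hm
      obtain rfl : j = L := by omega
      refine ⟨m, hm, fun k => ?_⟩
      have hb := hend m hm
      exact (Reaches.one (by simp [step, hb])).mono (by omega)
    | succ s ih =>
      intro j hj m hm
      obtain ⟨hb, hI⟩ := hstep j (by omega) m hm
      obtain ⟨m', hm', hr⟩ := ih (j + 1) (by omega) _ hI
      refine ⟨m', hm', fun k => ?_⟩
      have h1 : Reaches O 1 (.while b p :: k, m) (p :: .while b p :: k, m) :=
        Reaches.one (by simp [step, hb])
      refine ((h1.trans (reaches_exec p hp _ m)).trans (hr k)).mono ?_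
      rw [Nat.succ_mul]; omega
  simpa using key L 0 (by omega) m hm

/-- A loop with a potential function on abstract states. -/
theorem cost_while_le {ι : Type*} {b : Test} {p : Cmd} {k : List Cmd} (I : ι → Mem → Prop)
    (V : ι → ENNReal) (N : ℕ)
    (hend : ∀ s m, I s m → b.eval m = false → ∀ N' ≤ N, 1 + cost O φ N' (k, m) ≤ V s)
    (hstep : ∀ s m, I s m → b.eval m = true → ∀ (N' : ℕ) (k' : List Cmd),
      (∀ s' m', I s' m' → cost O φ N' (k', m') ≤ V s') → 1 + cost O φ N' (p :: k', m) ≤ V s) :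
    ∀ s m, I s m → cost O φ N (.while b p :: k, m) ≤ V s := by
  -- The induction runs on the truncation index, which drops with every test of the loop. No
  -- termination argument is needed: the bound is uniform in the index and yields finite expected
  -- time afterwards.
  suffices h : ∀ N' ≤ N, ∀ s m, I s m → cost O φ N' (.while b p :: k, m) ≤ V s from h N le_rfl
  intro N'
  induction N' with
  | zero => intro _ s m _; simp [cost]
  | succ N' ih =>
    intro hN s m hI
    cases hb : b.eval m with
    | true =>
      rw [cost_cons, step, hb, if_pos rfl, tsum_pure_mul]
      exact hstep s m hI hb N' _ (ih (by omega))
    | false =>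
      rw [cost_cons, step, hb]
      simp only [Bool.false_eq_true, if_false, tsum_pure_mul]
      exact hend s m hI hb N' (by omega)

/-! ### Random cuts of forests -/

/-- A forest order: the ancestors of every element form a chain. -/
structure IsForest {α : Type*} (R : α → α → Prop) : Prop where
  irrefl : ∀ a, ¬ R a a
  trans : ∀ a b c, R a b → R b c → R a c
  chain : ∀ a b t, R a t → R b t → a = b ∨ R a b ∨ R b a

/-- The reflexive closure of `R`. -/
def Ge {α : Type*} (R : α → α → Prop) (a b : α) : Prop := a = b ∨ R a b

section Forest

variable {α : Type*} {R : α → α → Prop}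

theorem Ge.refl (a : α) : Ge R a a := Or.inl rfl

theorem IsForest.ge_trans (h : IsForest R) {a b c : α} (hab : Ge R a b) (hbc : Ge R b c) :
    Ge R a c := by
  rcases hab with rfl | hab
  · exact hbc
  · rcases hbc with rfl | hbc
    · exact Or.inr hab
    · exact Or.inr (h.trans _ _ _ hab hbc)

theorem IsForest.trans_ge (h : IsForest R) {a b c : α} (hab : R a b) (hbc : Ge R b c) :
    R a c := by
  rcases hbc with rfl | hbc
  · exact hab
  · exact h.trans _ _ _ hab hbc

theorem IsForest.ge_trans' (h : IsForest R) {a b c : α} (hab : Ge R a b) (hbc : R b c) :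
    R a c := by
  rcases hab with rfl | hab
  · exact hbc
  · exact h.trans _ _ _ hab hbc

theorem IsForest.not_ge (h : IsForest R) {a b : α} (hab : R a b) : ¬ Ge R b a := fun hb =>
  h.irrefl _ (h.trans_ge hab hb)

theorem IsForest.ge_chain (h : IsForest R) {a b t : α} (ha : Ge R a t) (hb : Ge R b t) :
    Ge R a b ∨ R b a := by
  rcases ha with rfl | ha
  · rcases hb with rfl | hb
    · exact Or.inl (Ge.refl _)
    · exact Or.inr hb
  · rcases hb with rfl | hb
    · exact Or.inl (Or.inr ha)
    · rcases h.chain a b t ha hb with h | h | h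
      · exact Or.inl (Or.inl h)
      · exact Or.inl (Or.inr h)
      · exact Or.inr h

open Classical in
/-- The elements of `S` that are dominated by or equal to `z`. -/
noncomputable def down (R : α → α → Prop) (S : Finset α) (z : α) : Finset α :=
  S.filter fun s => Ge R z s

open Classical in
/-- The maximal elements of `S`. -/
noncomputable def tops (R : α → α → Prop) (S : Finset α) : Finset α :=
  S.filter fun s => ∀ u ∈ S, ¬ R u s

open Classical in
/-- The part of `S` below the highest element of `S` that is `≽ x` but not `≽ y`. -/
noncomputable def cutSet (R : α → α → Prop) (S : Finset α) (x y : α) : Finset α :=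
  S.filter fun s => ∃ z ∈ S, Ge R z x ∧ ¬ Ge R z y ∧ Ge R z s

theorem mem_down {S : Finset α} {z s : α} : s ∈ down R S z ↔ s ∈ S ∧ Ge R z s := by
  simp [down]

theorem mem_tops {S : Finset α} {s : α} : s ∈ tops R S ↔ s ∈ S ∧ ∀ u ∈ S, ¬ R u s := by
  simp [tops]

theorem mem_cutSet {S : Finset α} {x y s : α} :
    s ∈ cutSet R S x y ↔ s ∈ S ∧ ∃ z ∈ S, Ge R z x ∧ ¬ Ge R z y ∧ Ge R z s := by
  simp [cutSet]

/-- This is the case of a wasted round: an empty cut leaves the potential unchanged, so such pairs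
can stay in the average over all pairs. -/
theorem cutSet_eq_empty (h : IsForest R) {S : Finset α} {x y : α} (hxy : Ge R x y) :
    cutSet R S x y = ∅ := by
  ext s
  simp only [mem_cutSet, Finset.notMem_empty, iff_false]
  rintro ⟨_, z, _, h1, h2, _⟩
  exact h2 (h.ge_trans h1 hxy)

/-- All witnesses in `cutSet` lie below `z`, so the union of their subtrees is the subtree of `z`.
This links the cut made by the program, which is described by `z`, with the averaged one, which is
defined without choosing `z`. -/
theorem cutSet_eq_down (h : IsForest R) {S : Finset α} {x y z : α} (hz : z ∈ S) (hzx : Ge R z x)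
    (hzy : ¬ Ge R z y) (hmax : ∀ s ∈ S, Ge R s x → ¬ Ge R s y → Ge R z s) :
    cutSet R S x y = down R S z := by
  ext s
  rw [mem_cutSet, mem_down]
  refine and_congr_right fun _ => ⟨?_, fun hs => ⟨z, hz, hzx, hzy, hs⟩⟩
  rintro ⟨z', h0, h1, h2, h3⟩
  exact h.ge_trans (hmax z' h0 h1 h2) h3

theorem exists_top (h : IsForest R) {S : Finset α} {x : α} (hx : x ∈ S) :
    ∃ b ∈ tops R S, Ge R b x := by
  classical
  -- Moving strictly upwards strictly enlarges the set of dominated elements, so an element above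
  -- `x` with the most dominated elements is maximal in `S`.
  obtain ⟨b, hb, hmax⟩ := Finset.exists_max_image (S.filter fun b => Ge R b x)
    (fun b => (down R S b).card) ⟨x, by simp [hx, Ge.refl]⟩
  rw [Finset.mem_filter] at hb
  refine ⟨b, mem_tops.2 ⟨hb.1, fun u hu hub => ?_⟩, hb.2⟩
  have h1 := hmax u (by simp [hu, h.ge_trans (Or.inr hub) hb.2])
  refine absurd h1 (not_le.2 (Finset.card_lt_card ?_))
  rw [Finset.ssubset_iff_of_subset]
  · exact ⟨u, mem_down.2 ⟨hu, Ge.refl _⟩, fun hu' => h.not_ge hub (mem_down.1 hu').2⟩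
  · intro s hs
    rw [mem_down] at hs ⊢
    exact ⟨hs.1, h.ge_trans (Or.inr hub) hs.2⟩

theorem tops_disjoint (h : IsForest R) {S : Finset α} :
    Set.PairwiseDisjoint (tops R S : Set α) (fun b => down R S b) := by
  intro b hb b' hb' hne
  rw [Finset.mem_coe, mem_tops] at hb hb'
  rw [Function.onFun, Finset.disjoint_left]
  intro s hs hs'
  rw [mem_down] at hs hs'
  rcases h.ge_chain hs.2 hs'.2 with (h1 | h1) | h1
  · exact hne h1
  · exact hb'.2 b hb.1 h1
  · exact hb.2 b' hb'.1 h1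

theorem biUnion_tops [DecidableEq α] (h : IsForest R) {S : Finset α} :
    (tops R S).biUnion (fun b => down R S b) = S := by
  ext s
  rw [Finset.mem_biUnion]
  constructor
  · rintro ⟨b, _, hs⟩
    exact (mem_down.1 hs).1
  · intro hs
    obtain ⟨b, hb, hbs⟩ := exists_top h hs
    exact ⟨b, hb, mem_down.2 ⟨hs, hbs⟩⟩

/-- The smaller part of a random cut, counted from the elements outside of a large subtree. -/
theorem outside_count (h : IsForest R) {S : Finset α} {c : α} (hc : c ∈ S)
    (hbig : S.card ≤ 2 * (down R S c).card) [DecidableEq α] :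
    (down R S c).card * (S \ down R S c).card ^ 2 ≤
      2 * ∑ x ∈ S, ∑ y ∈ S, min (cutSet R S x y).card (S.card - (cutSet R S x y).card) := by
  classical
  set G := down R S c with hG
  set O := S \ G with hO
  have hGS : G ⊆ S := fun s hs => (mem_down.1 hs).1
  have hOS : O ⊆ S := Finset.sdiff_subset
  have key : ∀ x ∈ G, O.card ^ 2 ≤
      2 * ∑ y ∈ O, min (cutSet R S x y).card (S.card - (cutSet R S x y).card) := by
    intro x hx
    have hcx := (mem_down.1 hx).2
    -- Since `c ≽ x` but not `c ≽ y`, the cut contains all of `G`, which is at least as large as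
    -- `O`. The elements of `O` that the cut misses are therefore no more numerous than either part.
    have h1 : ∀ y ∈ O, (O.filter fun y' => y' ∉ cutSet R S x y).card ≤
        min (cutSet R S x y).card (S.card - (cutSet R S x y).card) := by
      intro y hy
      have hyO := Finset.mem_sdiff.1 hy
      have hsub : cutSet R S x y ⊆ S := fun s hs => (mem_cutSet.1 hs).1
      have hG2 : G ⊆ cutSet R S x y := fun s hs =>
        mem_cutSet.2 ⟨hGS hs, c, hc, hcx, fun hcy => hyO.2 (mem_down.2 ⟨hyO.1, hcy⟩),
          (mem_down.1 hs).2⟩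
      have h2 := Finset.card_le_card hG2
      have h3 : (O.filter fun y' => y' ∉ cutSet R S x y).card ≤ (S \ cutSet R S x y).card := by
        refine Finset.card_le_card fun s hs => ?_
        rw [Finset.mem_filter] at hs
        exact Finset.mem_sdiff.2 ⟨hOS hs.1, hs.2⟩
      rw [Finset.card_sdiff_of_subset hsub] at h3
      omega
    -- For `y, y'` in `O`, `y'` escapes the cut for `y` or `y` escapes the cut for `y'`. Otherwise
    -- the two witnesses, both `≽ x`, are comparable, and the higher one dominates the very element
    -- that it must not dominate. By the symmetry of swapping, on average at least half of `O`
    -- escapes.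
    have h2 : O.card ^ 2 ≤ 2 * ((O ×ˢ O).filter fun p => p.2 ∉ cutSet R S x p.1).card := by
      have h3 : (O ×ˢ O) ⊆ ((O ×ˢ O).filter fun p => p.2 ∉ cutSet R S x p.1) ∪
          ((O ×ˢ O).filter fun p => p.1 ∉ cutSet R S x p.2) := by
        rintro ⟨y, y'⟩ hp
        rw [Finset.mem_union, Finset.mem_filter, Finset.mem_filter]
        by_contra hcon
        push Not at hcon
        obtain ⟨-, z, -, h1, h2, h3⟩ := mem_cutSet.1 (hcon.1 hp)
        obtain ⟨-, z', -, h1', h2', h3'⟩ := mem_cutSet.1 (hcon.2 hp)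
        rcases h.ge_chain h1 h1' with hzz | hzz
        · exact h2 (h.ge_trans hzz h3')
        · exact h2' (h.ge_trans (Or.inr hzz) h3)
      have h4 := (Finset.card_le_card h3).trans (Finset.card_union_le _ _)
      have h5 : ((O ×ˢ O).filter fun p => p.1 ∉ cutSet R S x p.2).card =
          ((O ×ˢ O).filter fun p => p.2 ∉ cutSet R S x p.1).card := by
        refine Finset.card_bij (fun p _ => p.swap) ?_ ?_ ?_
        · rintro ⟨a, b⟩ hp
          simp only [Finset.mem_filter, Finset.mem_product, Prod.swap] at hp ⊢
          exact ⟨hp.1.symm, hp.2⟩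
        · intro a _ b _ hab
          exact Prod.swap_injective hab
        · rintro ⟨a, b⟩ hp
          simp only [Finset.mem_filter, Finset.mem_product] at hp
          exact ⟨(b, a), by simpa [Finset.mem_filter, Finset.mem_product] using
            ⟨hp.1.symm, hp.2⟩, rfl⟩
      rw [Finset.card_product] at h4
      rw [sq]
      omega
    have h3 : ((O ×ˢ O).filter fun p => p.2 ∉ cutSet R S x p.1).card =
        ∑ y ∈ O, (O.filter fun y' => y' ∉ cutSet R S x y).card := by
      rw [Finset.card_filter, Finset.sum_product]
      refine Finset.sum_congr rfl fun y _ => ?_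
      rw [Finset.card_filter]
    rw [h3] at h2
    have h4 := Finset.sum_le_sum h1
    omega
  have h1 := Finset.sum_le_sum key
  rw [Finset.sum_const, smul_eq_mul, ← Finset.mul_sum] at h1
  refine h1.trans (Nat.mul_le_mul_left 2 ?_)
  refine le_trans ?_ (Finset.sum_le_sum_of_subset hGS)
  exact Finset.sum_le_sum fun x _ => Finset.sum_le_sum_of_subset hOS

/-- The smaller part of a random cut, counted from the cuts at the maximal elements of `B`. -/
theorem inside_count (h : IsForest R) {S G B : Finset α} {d : ℕ} (hBS : B ⊆ S) (hGS : G ⊆ S)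
    (hdown : ∀ b ∈ B, ∀ s ∈ S, Ge R b s → s ∈ B)
    (htop : ∀ b ∈ tops R B, ∀ z ∈ S, R z b → ∀ y ∈ G, Ge R z y)
    (hd : (tops R B).card ≤ d) {e : ℕ}
    (hsmall : ∀ b ∈ B, 2 * (down R S b).card ≤ S.card)
    (he : ∀ b ∈ B, e + (down R S b).card ≤ G.card) :
    e * B.card ^ 2 ≤
      d * ∑ x ∈ S, ∑ y ∈ S, min (cutSet R S x y).card (S.card - (cutSet R S x y).card) := by
  classical
  have hdB : ∀ b ∈ B, down R B b = down R S b := by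
    intro b hb
    ext s
    rw [mem_down, mem_down]
    exact ⟨fun hs => ⟨hBS hs.1, hs.2⟩, fun hs => ⟨hdown b hb s hs.1 hs.2, hs.2⟩⟩
  have htB : ∀ b ∈ tops R B, b ∈ B := fun b hb => (mem_tops.1 hb).1
  have hcard : B.card = ∑ b ∈ tops R B, (down R S b).card := by
    conv_lhs => rw [← biUnion_tops h (S := B)]
    rw [Finset.card_biUnion (fun b hb b' hb' hne => tops_disjoint h hb hb' hne)]
    exact Finset.sum_congr rfl fun b hb => by rw [hdB b (htB b hb)]
  -- This is the only place in the count where the degree bound is used: `B` falls into at most `d`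
  -- subtrees, so the sum of squares of their sizes is at least `|B|² / d`.
  have hCS : B.card ^ 2 ≤ d * ∑ b ∈ tops R B, (down R S b).card ^ 2 := by
    rw [hcard]
    exact (sq_sum_le_card_mul_sum_sq).trans (Nat.mul_le_mul_right _ hd)
  have hcut : ∀ b ∈ tops R B, ∀ x ∈ down R S b, ∀ y ∈ G \ down R S b,
      cutSet R S x y = down R S b := by
    intro b hb x hx y hy
    rw [Finset.mem_sdiff] at hy
    rw [mem_down] at hx
    refine cutSet_eq_down h (hBS (htB b hb)) hx.2
      (fun hby => hy.2 (mem_down.2 ⟨hGS hy.1, hby⟩)) fun s hs hsx hsy => ?_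
    -- An element `≽ x` is comparable with `b`. If it lies strictly above `b`, it dominates all of
    -- `G` by `htop`, hence `y`, so it is no candidate; thus `b` is the highest one.
    rcases h.ge_chain hx.2 hsx with h1 | h1
    · exact h1
    · exact absurd (htop b hb s hs h1 y hy.1) hsy
  have hmain : ∑ b ∈ tops R B, e * (down R S b).card ^ 2 ≤
      ∑ x ∈ S, ∑ y ∈ S, min (cutSet R S x y).card (S.card - (cutSet R S x y).card) := by
    refine le_trans ?_ (Finset.sum_le_sum_of_subset hBS)
    conv_rhs => rw [← biUnion_tops h (S := B)]
    rw [Finset.sum_biUnion (tops_disjoint h)]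
    refine Finset.sum_le_sum fun b hb => ?_
    rw [hdB b (htB b hb)]
    have h1 : ∀ x ∈ down R S b, e * (down R S b).card ≤
        ∑ y ∈ S, min (cutSet R S x y).card (S.card - (cutSet R S x y).card) := by
      intro x hx
      refine le_trans ?_ (Finset.sum_le_sum_of_subset
        (Finset.sdiff_subset.trans hGS : G \ down R S b ⊆ S))
      have h2 : ∀ y ∈ G \ down R S b, (down R S b).card ≤
          min (cutSet R S x y).card (S.card - (cutSet R S x y).card) := by
        intro y hy
        rw [hcut b hb x hx y hy]
        have := hsmall b (htB b hb)
        omega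
      refine le_trans ?_ (Finset.sum_le_sum h2)
      rw [Finset.sum_const, smul_eq_mul]
      refine Nat.mul_le_mul_right _ ?_
      have h3 := Finset.le_card_sdiff (down R S b) G
      have h4 := he b (htB b hb)
      omega
    refine le_trans ?_ (Finset.sum_le_sum h1)
    rw [Finset.sum_const, smul_eq_mul]
    exact le_of_eq (by ring)
  rw [← Finset.mul_sum] at hmain
  calc e * B.card ^ 2 ≤ e * (d * ∑ b ∈ tops R B, (down R S b).card ^ 2) :=
        Nat.mul_le_mul_left _ hCS
    _ = d * (e * ∑ b ∈ tops R B, (down R S b).card ^ 2) := by ring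
    _ ≤ _ := Nat.mul_le_mul_left _ hmain

/-- The expected size of the smaller part of a random cut is at least the size of the forest
divided by a multiple of the degree. -/
theorem random_cut (h : IsForest R) {S : Finset α} {d : ℕ} (hS : 2 ≤ S.card)
    (hd : (tops R S).card ≤ d) (hd' : ∀ c ∈ S, ∀ B : Finset α,
      (∀ s, s ∈ B ↔ s ∈ S ∧ R c s) → (tops R B).card ≤ d) :
    S.card ^ 3 ≤ 256 * d *
      ∑ x ∈ S, ∑ y ∈ S, min (cutSet R S x y).card (S.card - (cutSet R S x y).card) := by
  classical
  set T := ∑ x ∈ S, ∑ y ∈ S, min (cutSet R S x y).card (S.card - (cutSet R S x y).card) with hT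
  have hd1 : 1 ≤ d := by
    obtain ⟨x, hx⟩ := Finset.card_pos.1 (by omega : 0 < S.card)
    obtain ⟨b, hb, _⟩ := exists_top h hx
    exact le_trans (Finset.card_pos.2 ⟨b, hb⟩) hd
  by_cases hH : ∃ c ∈ S, S.card < 2 * (down R S c).card
  -- The smallest subtree with more than half of `S`: by minimality, every strict descendant of its
  -- root has at most half of `S` below it.
  · obtain ⟨c, hc, hmin⟩ := Finset.exists_min_image
      (S.filter fun c => S.card < 2 * (down R S c).card) (fun c => (down R S c).card)
      (by obtain ⟨c, hc, h1⟩ := hH; exact ⟨c, by simp [hc, h1]⟩)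
    rw [Finset.mem_filter] at hc
    obtain ⟨hcS, hcbig⟩ := hc
    have hGS : down R S c ⊆ S := fun s hs => (mem_down.1 hs).1
    have hO := Finset.card_sdiff_of_subset hGS
    have hGle := Finset.card_le_card hGS
    by_cases hcase : S.card ≤ 8 * (S \ down R S c).card
    · have h1 := outside_count h hcS hcbig.le
      rw [← hT] at h1
      set g := (down R S c).card
      set o := (S \ down R S c).card
      set m := S.card
      -- This case determines the constant: `m³ ≤ 128 g o²` and `g o² ≤ 2 T` give 256. The factor `d
      -- ≥ 1` is added only to match the other cases.
      have h2 : m * m ^ 2 ≤ (2 * g) * (8 * o) ^ 2 := by gcongr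
      have h3 : 1 * T ≤ d * T := Nat.mul_le_mul_right _ hd1
      nlinarith
    · set B := S.filter fun s => R c s with hB
      have hBmem : ∀ s, s ∈ B ↔ s ∈ S ∧ R c s := fun s => by simp [hB]
      have hGB : down R S c ⊆ insert c B := by
        intro s hs
        rw [mem_down] at hs
        rw [Finset.mem_insert, hBmem]
        rcases hs.2 with h1 | h1
        · exact Or.inl h1.symm
        · exact Or.inr ⟨hs.1, h1⟩
      have hBcard := (Finset.card_le_card hGB).trans (Finset.card_insert_le _ _)
      have hsm : ∀ b ∈ B, 2 * (down R S b).card ≤ S.card := by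
        intro b hb
        rw [hBmem] at hb
        by_contra hcon
        have h1 := hmin b (by simp only [Finset.mem_filter]; exact ⟨hb.1, by omega⟩)
        refine absurd h1 (not_le.2 (Finset.card_lt_card ?_))
        rw [Finset.ssubset_iff_of_subset]
        · exact ⟨c, mem_down.2 ⟨hcS, Ge.refl _⟩, fun hc' => h.not_ge hb.2 (mem_down.1 hc').2⟩
        · intro s hs
          rw [mem_down] at hs ⊢
          exact ⟨hs.1, h.ge_trans (Or.inr hb.2) hs.2⟩
      have h1 := inside_count h (S := S) (G := down R S c) (B := B) (d := d)
        (e := (down R S c).card - S.card / 2)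
        (fun s hs => ((hBmem s).1 hs).1) hGS
        (fun b hb s hs hbs => (hBmem s).2 ⟨hs, h.trans_ge ((hBmem b).1 hb).2 hbs⟩)
        (by
          intro b hb z hz hzb y hy
          rw [mem_tops] at hb
          have hcb := ((hBmem b).1 hb.1).2
          rcases h.chain z c b hzb hcb with h1 | h1 | h1
          · exact h1 ▸ (mem_down.1 hy).2
          · exact h.ge_trans (Or.inr h1) (mem_down.1 hy).2
          · exact absurd hzb (hb.2 z ((hBmem z).2 ⟨hz, h1⟩)))
        (hd' c hcS B hBmem) hsm
        (by intro b hb; have := hsm b hb; omega)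
      rw [← hT] at h1
      set g := (down R S c).card
      set m := S.card
      set k := B.card
      -- Here `g > 7m/8`, so each `b` leaves at least `g - m/2 ≥ 3m/8` elements of `G` as choices
      -- for `y`. Removing the root `c` costs one element, and `8k ≥ 3m` still holds because `m ≥
      -- 2`.
      have h2 : (3 * m) * (3 * m) ^ 2 ≤ (8 * (g - m / 2)) * (8 * k) ^ 2 := by
        have h3 : 3 * m ≤ 8 * (g - m / 2) := by omega
        have h4 : 3 * m ≤ 8 * k := by omega
        exact Nat.mul_le_mul h3 (Nat.pow_le_pow_left h4 2)
      nlinarith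
  · push Not at hH
    -- Without a large subtree, the trees of `S` itself play the role of the subtrees of the
    -- children; nothing in `S` lies above their roots.
    have h1 := inside_count h (S := S) (G := S) (B := S) (d := d) (e := S.card - S.card / 2)
      subset_rfl subset_rfl (fun b _ s hs _ => hs)
      (fun b hb z hz hzb => absurd hzb ((mem_tops.1 hb).2 z hz)) hd hH
      (by intro b hb; have := hH b hb; omega)
    rw [← hT] at h1
    set m := S.card
    have h2 : m * m ^ 2 ≤ (2 * (m - m / 2)) * m ^ 2 := by gcongr; omega
    nlinarith

end Forest

/-! ### Segments and their cuts -/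

section Segments

variable {R : ℕ → ℕ → Prop} {n : ℕ}

/-- The elements at the positions `a, …, b - 1`. -/
def seg (ord : ℕ → ℕ) (a b : ℕ) : Finset ℕ := (Finset.Ico a b).image ord

theorem mem_seg {ord : ℕ → ℕ} {a b v : ℕ} :
    v ∈ seg ord a b ↔ ∃ i, (a ≤ i ∧ i < b) ∧ ord i = v := by
  simp [seg]

/-- All elements of `S` have the same entry `p` in `par`, and the ancestors of an element of `S` are
its ancestors in `S`, the element `p` and the ancestors of `p`. The entry `n` stands for
the absence of a parent. -/
def Closed (R : ℕ → ℕ → Prop) (n : ℕ) (par : ℕ → ℕ) (S : Finset ℕ) : Prop :=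
  ∃ p ≤ n, ∀ v ∈ S, par v = p ∧ ∀ u, R u v ↔ (u ∈ S ∧ R u v) ∨ (u < n ∧ Ge R u p)

/-- The element `w` is the lowest ancestor of `z` in `S`, or the entry of `z` in `par` if there is
no such ancestor. -/
def IsParent (R : ℕ → ℕ → Prop) (par : ℕ → ℕ) (S : Finset ℕ) (z w : ℕ) : Prop :=
  (w = par z ∧ ∀ s ∈ S, ¬ R s z) ∨ (w ∈ S ∧ R w z ∧ ∀ s ∈ S, R s z → Ge R s w)

/-- What lies below an element of the removed subtree was removed too, so no survivor loses an
ancestor. -/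
theorem Closed.rest {par par' : ℕ → ℕ} {S : Finset ℕ} {z : ℕ} (h : IsForest R)
    (hS : Closed R n par S) (hpar : ∀ v ∈ S, v ∉ down R S z → par' v = par v) :
    Closed R n par' (S \ down R S z) := by
  obtain ⟨p, hpn, hp⟩ := hS
  refine ⟨p, hpn, fun v hv => ?_⟩
  rw [Finset.mem_sdiff] at hv
  obtain ⟨h1, h2⟩ := hp v hv.1
  refine ⟨(hpar v hv.1 hv.2).trans h1, fun u => ?_⟩
  refine (h2 u).trans (or_congr_left
    ⟨fun ⟨hu, huv⟩ => ?_, fun ⟨hu, huv⟩ => ⟨(Finset.mem_sdiff.1 hu).1, huv⟩⟩)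
  refine ⟨Finset.mem_sdiff.2 ⟨hu, fun hd => hv.2 ?_⟩, huv⟩
  exact mem_down.2 ⟨hv.1, h.ge_trans (mem_down.1 hd).2 (Or.inr huv)⟩

/-- An ancestor in `S` of an element below `z` is comparable with `z`: it is either in the subtree
or strictly above `z`. In the latter case it is `≽ w`, as `w` is the lowest such element; if there
is none, the old parent remains valid. -/
theorem Closed.below {par par' : ℕ → ℕ} {S : Finset ℕ} {z w : ℕ} (h : IsForest R)
    (hn : ∀ u v, R u v → u < n ∧ v < n)
    (hS : Closed R n par S) (hz : z ∈ S) (hw : IsParent R par S z w)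
    (hpar : ∀ v ∈ down R S z, par' v = w) :
    Closed R n par' (down R S z) := by
  obtain ⟨p, hpn, hp⟩ := hS
  have hwn : w ≤ n := by
    rcases hw with ⟨rfl, _⟩ | ⟨_, hwz, _⟩
    · rw [(hp z hz).1]; exact hpn
    · exact (hn _ _ hwz).1.le
  refine ⟨w, hwn, fun v hv => ⟨hpar v hv, fun u => ?_⟩⟩
  obtain ⟨hvS, hzv⟩ := mem_down.1 hv
  have hv' := (hp v hvS).2
  obtain ⟨hpz, hz'⟩ := hp z hz
  have hmem : ∀ u, u ∈ S → R u v → u ∈ down R S z ∨ R u z := by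
    intro u hu huv
    rcases h.ge_chain hzv (Or.inr huv : Ge R u v) with h1 | h1
    · exact Or.inl (mem_down.2 ⟨hu, h1⟩)
    · exact Or.inr h1
  rcases hw with ⟨rfl, hw⟩ | ⟨hwS, hwz, hw⟩
  · rw [hpz]
    refine (hv' u).trans (or_congr_left
      ⟨fun ⟨hu, huv⟩ => ⟨?_, huv⟩, fun ⟨hu, huv⟩ => ⟨(mem_down.1 hu).1, huv⟩⟩)
    rcases hmem u hu huv with h1 | h1
    · exact h1
    · exact absurd h1 (hw u hu)
  · constructor
    · intro huv
      rcases (hv' u).1 huv with ⟨hu, _⟩ | ⟨hu, hup⟩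
      · rcases hmem u hu huv with h1 | h1
        · exact Or.inl ⟨h1, huv⟩
        · exact Or.inr ⟨(hn _ _ huv).1, hw u hu h1⟩
      · exact Or.inr ⟨hu, Or.inr (((hp w hwS).2 u).2 (Or.inr ⟨hu, hup⟩))⟩
    · rintro (⟨_, huv⟩ | ⟨_, huw⟩)
      · exact huv
      · exact h.trans_ge (h.ge_trans' huw hwz) hzv

/-- The positions `a, …, b - 1` hold a part of the forest that can be sorted on its own. -/
def Good (R : ℕ → ℕ → Prop) (n : ℕ) (ord par : ℕ → ℕ) (a b : ℕ) : Prop :=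
  b ≤ n ∧ Closed R n par (seg ord a b) ∧
    ∀ i, a ≤ i → i < b → ∀ j < n, R (ord j) (ord i) → j < b

/-- The positions from `a` on are divided into good segments, whose ends are listed by the list. -/
def Segs (R : ℕ → ℕ → Prop) (n : ℕ) (ord par e : ℕ → ℕ) : ℕ → List ℕ → Prop
  | a, [] => a = n
  | a, b :: L => (a < b ∧ e a = b) ∧ Good R n ord par a b ∧ Segs R n ord par e b L

/-- Below the position `a`, the elements are in order and `par` holds their parents. -/
def Settled (R : ℕ → ℕ → Prop) (n : ℕ) (ord par : ℕ → ℕ) (a : ℕ) : Prop :=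
  ∀ i < a, par (ord i) ≤ n ∧ (∀ u, R u (ord i) ↔ u < n ∧ Ge R u (par (ord i))) ∧
    ∀ j < n, R (ord j) (ord i) → j < i

theorem seg_congr {ord ord' : ℕ → ℕ} {a b : ℕ} (h : ∀ i, a ≤ i → i < b → ord' i = ord i) :
    seg ord' a b = seg ord a b := by
  ext v
  rw [mem_seg, mem_seg]
  exact exists_congr fun i => and_congr_right fun hi => by rw [h i hi.1 hi.2]

theorem Segs.congr {ord par e ord' par' e' : ℕ → ℕ} {L : List ℕ} : ∀ {a s : ℕ}, s ≤ a →
    (∀ i, s ≤ i → i < n → ord' i = ord i ∧ e' i = e i ∧ par' (ord i) = par (ord i)) →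
    Segs R n ord par e a L → Segs R n ord' par' e' a L := by
  induction L with
  | nil => intro a s _ _ h; exact h
  | cons b L ih =>
    intro a s hs hagree h
    obtain ⟨⟨hab, hea⟩, ⟨hbn, hcl, hord⟩, hL⟩ := h
    have hseg : seg ord' a b = seg ord a b :=
      seg_congr fun i h1 h2 => (hagree i (hs.trans h1) (by omega)).1
    refine ⟨⟨hab, ((hagree a hs (by omega)).2.1).trans hea⟩, ⟨hbn, ?_, ?_⟩,
      ih (by omega : s ≤ b) hagree hL⟩
    · rw [hseg]
      obtain ⟨p, hpn, hp⟩ := hcl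
      refine ⟨p, hpn, fun v hv => ⟨?_, (hp v hv).2⟩⟩
      obtain ⟨i, hi, rfl⟩ := mem_seg.1 hv
      rw [(hagree i (hs.trans hi.1) (by omega)).2.2]
      exact (hp _ hv).1
    · intro i h1 h2 j hj hji
      rcases lt_or_ge j s with h3 | h3
      · omega
      · rw [(hagree j h3 hj).1, (hagree i (hs.trans h1) (by omega)).1] at hji
        exact hord i h1 h2 j hj hji

/-- In a one-element segment the summand "ancestors inside the segment" of `Closed` is empty, so the
provisional parent has become the true one. -/
theorem Settled.step {ord par : ℕ → ℕ} {a : ℕ} (h : IsForest R)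
    (hs : Settled R n ord par a) (hg : Good R n ord par a (a + 1)) :
    Settled R n ord par (a + 1) := by
  intro i hi
  rcases Nat.lt_succ_iff_lt_or_eq.1 hi with hi | rfl
  · exact hs i hi
  obtain ⟨_, ⟨p, hpn, hp⟩, hord⟩ := hg
  have hmem : ∀ u, u ∈ seg ord i (i + 1) ↔ u = ord i := by
    intro u; simp [seg]
  obtain ⟨h1, h2⟩ := hp (ord i) ((hmem _).2 rfl)
  refine ⟨h1 ▸ hpn, fun u => ?_, fun j hj hji => ?_⟩
  · rw [h2 u, h1, or_iff_right]
    rintro ⟨hu, hu'⟩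
    rw [(hmem u).1 hu] at hu'
    exact h.irrefl _ hu'
  · have h3 := hord i le_rfl (by omega) j hj hji
    have h4 : j ≠ i := by rintro rfl; exact h.irrefl _ hji
    omega

theorem card_seg {ord : ℕ → ℕ} {a b : ℕ} (hinj : Set.InjOn ord (Set.Iio n)) (hb : b ≤ n) :
    (seg ord a b).card = b - a := by
  rw [seg, Finset.card_image_of_injOn, Nat.card_Ico]
  intro i hi j hj hij
  rw [Finset.mem_coe, Finset.mem_Ico] at hi hj
  exact hinj (show i < n by omega) (show j < n by omega) hij

/-- The result of moving the elements below `z` to the end of a segment. -/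
theorem segs_cut {ord par e par' : ℕ → ℕ} {π : Equiv.Perm ℕ} {a b c z w : ℕ} {L : List ℕ}
    (h : IsForest R) (hn : ∀ u v, R u v → u < n ∧ v < n)
    (hinj : Set.InjOn ord (Set.Iio n))
    (hsegs : Segs R n ord par e a (b :: L)) (hset : Settled R n ord par a)
    (hz : z ∈ seg ord a b) (hzy : ∃ y ∈ seg ord a b, ¬ Ge R z y)
    (hw : IsParent R par (seg ord a b) z w)
    (hπ : ∀ k, k < a ∨ b ≤ k → π k = k) (hac : a ≤ c) (hcb : c ≤ b)
    (hlow : ∀ k, a ≤ k → k < c → ¬ Ge R z (ord (π k)))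
    (hhigh : ∀ k, c ≤ k → k < b → Ge R z (ord (π k)))
    (hpar : ∀ v ∈ down R (seg ord a b) z, par' v = w)
    (hpar' : ∀ v, v ∉ down R (seg ord a b) z → par' v = par v) :
    (b - c = (down R (seg ord a b) z).card ∧ c - a = b - a - (down R (seg ord a b) z).card) ∧
    Set.InjOn (fun k => ord (π k)) (Set.Iio n) ∧
    (∀ k < n, π k < n) ∧
    Segs R n (fun k => ord (π k)) par' (Function.update (Function.update e a c) c b) a
      (c :: b :: L) ∧
    Settled R n (fun k => ord (π k)) par' a := by
  obtain ⟨⟨hab, hea⟩, ⟨hbn, hcl, hord⟩, hL⟩ := hsegs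
  have hin : ∀ k, a ≤ k → k < b → a ≤ π k ∧ π k < b := by
    intro k h1 h2
    by_contra hcon
    have h3 : π (π k) = π k := hπ _ (by omega)
    have h4 := π.injective h3
    omega
  have hpn : ∀ k < n, π k < n := by
    intro k hk
    by_cases hkk : a ≤ k ∧ k < b
    · exact (hin k hkk.1 hkk.2).2.trans_le hbn
    · rw [hπ k (by omega)]; exact hk
  have hsub : ∀ {i j}, a ≤ i → j ≤ b → ∀ v ∈ seg (fun k => ord (π k)) i j, v ∈ seg ord a b := by
    intro i j hi hj v hv
    obtain ⟨k, hk, rfl⟩ := mem_seg.1 hv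
    exact mem_seg.2 ⟨π k, hin k (by omega) (by omega), rfl⟩
  have hinv : ∀ k, a ≤ k → k < b → ∃ k', (a ≤ k' ∧ k' < b) ∧ π k' = k := by
    intro k h1 h2
    refine ⟨π.symm k, ?_, by simp⟩
    by_contra hcon
    have h3 : π (π.symm k) = π.symm k := hπ _ (by omega)
    rw [Equiv.apply_symm_apply] at h3
    omega
  have hD : seg (fun k => ord (π k)) c b = down R (seg ord a b) z := by
    ext v
    constructor
    · intro hv
      refine mem_down.2 ⟨hsub hac le_rfl v hv, ?_⟩
      obtain ⟨k, hk, rfl⟩ := mem_seg.1 hv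
      exact hhigh k hk.1 hk.2
    · intro hv
      obtain ⟨hv, hzv⟩ := mem_down.1 hv
      obtain ⟨k, hk, rfl⟩ := mem_seg.1 hv
      obtain ⟨k', hk', rfl⟩ := hinv k hk.1 hk.2
      refine mem_seg.2 ⟨k', ⟨?_, hk'.2⟩, rfl⟩
      by_contra hcon
      exact hlow k' hk'.1 (by omega) hzv
  have hU : seg (fun k => ord (π k)) a c = seg ord a b \ down R (seg ord a b) z := by
    ext v
    rw [Finset.mem_sdiff]
    constructor
    · intro hv
      refine ⟨hsub le_rfl hcb v hv, fun hd => ?_⟩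
      obtain ⟨k, hk, rfl⟩ := mem_seg.1 hv
      exact hlow k hk.1 hk.2 (mem_down.1 hd).2
    · rintro ⟨hv, hd⟩
      have hv' := hv
      obtain ⟨k, hk, rfl⟩ := mem_seg.1 hv
      obtain ⟨k', hk', rfl⟩ := hinv k hk.1 hk.2
      refine mem_seg.2 ⟨k', ⟨hk'.1, ?_⟩, rfl⟩
      by_contra hcon
      exact hd (mem_down.2 ⟨hv', hhigh k' (by omega) hk'.2⟩)
  have hinj' : Set.InjOn (fun k => ord (π k)) (Set.Iio n) := fun i hi j hj hij =>
    π.injective (hinj (hpn i hi) (hpn j hj) hij)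
  -- Both parts are nonempty, since `y` stays behind and `z` is moved. The list of ends thus
  -- describes proper segments.
  have hc1 : a < c := by
    obtain ⟨y, hy, hzy⟩ := hzy
    have : y ∈ seg (fun k => ord (π k)) a c := by
      rw [hU, Finset.mem_sdiff]
      exact ⟨hy, fun hd => hzy (mem_down.1 hd).2⟩
    obtain ⟨k, hk, _⟩ := mem_seg.1 this
    omega
  have hc2 : c < b := by
    have : z ∈ seg (fun k => ord (π k)) c b := by
      rw [hD]
      exact mem_down.2 ⟨hz, Ge.refl _⟩
    obtain ⟨k, hk, _⟩ := mem_seg.1 this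
    omega
  have hcard : b - c = (down R (seg ord a b) z).card := by
    rw [← hD, card_seg hinj' hbn]
  have hposlt : ∀ i, a ≤ i → i < b → ∀ j < n, R (ord (π j)) (ord (π i)) → j < b := by
    intro i h1 h2 j hj hji
    obtain ⟨h3, h4⟩ := hin i h1 h2
    by_contra hcon
    rw [hπ j (by omega)] at hji
    exact hcon (hord _ h3 h4 j hj hji)
  refine ⟨⟨hcard, by omega⟩, hinj', hpn, ⟨⟨hc1, ?_⟩, ⟨by omega, ?_, ?_⟩, ⟨hc2, ?_⟩,
    ⟨hbn, ?_, ?_⟩, ?_⟩, ?_⟩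
  · rw [Function.update_of_ne (by omega), Function.update_self]
  · rw [hU]
    exact hcl.rest h fun v _ hv => hpar' v hv
  · intro i h1 h2 j hj hji
    -- An ancestor in the moved part would put its descendant below `z` and hence into the moved
    -- part as well.
    by_contra hcon
    have h3 := hposlt i h1 (by omega) j hj hji
    exact hlow i h1 h2 (h.ge_trans (hhigh j (by omega) h3) (Or.inr hji))
  · rw [Function.update_self]
  · rw [hD]
    exact hcl.below h hn hz hw hpar
  · intro i h1 h2 j hj hji
    exact hposlt i (by omega) h2 j hj hji
  · refine Segs.congr (s := b) le_rfl (fun i h1 h2 => ⟨?_, ?_, ?_⟩) hL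
    · simp only [hπ i (Or.inr h1)]
    · rw [Function.update_of_ne (by omega), Function.update_of_ne (by omega)]
    · refine hpar' _ fun hd => ?_
      obtain ⟨k, hk, hki⟩ := mem_seg.1 (mem_down.1 hd).1
      have := hinj (show k < n by omega) h2 hki
      omega
  · intro i hi
    have h1 : π i = i := hπ i (Or.inl hi)
    have h2 : par' (ord i) = par (ord i) := by
      refine hpar' _ fun hd => ?_
      obtain ⟨k, hk, hki⟩ := mem_seg.1 (mem_down.1 hd).1
      have := hinj (show k < n by omega) (show i < n by omega) hki
      omega
    simp only [h1, h2]
    refine ⟨(hset i hi).1, (hset i hi).2.1, fun j hj hji => ?_⟩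
    by_cases hjj : a ≤ j ∧ j < b
    · obtain ⟨h3, h4⟩ := hin j hjj.1 hjj.2
      have := (hset i hi).2.2 (π j) (by omega) hji
      omega
    · rw [hπ j (by omega)] at hji
      exact (hset i hi).2.2 j hj hji

/-- The numbers of roots and of children are at most `d`. -/
structure DegreeLe (R : ℕ → ℕ → Prop) (n d : ℕ) : Prop where
  roots : ∀ B : Finset ℕ, (∀ v ∈ B, v < n ∧ ∀ u, ¬ R u v) → B.card ≤ d
  children : ∀ (c : ℕ) (B : Finset ℕ), (∀ v ∈ B, R c v ∧ ∀ z, ¬ (R c z ∧ R z v)) → B.card ≤ d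

/-- The ancestors of a maximal element of a closed set are exactly `p` and what is above `p`. So
these elements are children of `p`, or roots if `p = n` stands for "no parent". -/
theorem Closed.tops_le {par : ℕ → ℕ} {S : Finset ℕ} {d : ℕ} (h : IsForest R)
    (hn : ∀ u v, R u v → u < n ∧ v < n) (hd : DegreeLe R n d) (hSn : ∀ v ∈ S, v < n)
    (hS : Closed R n par S) : (tops R S).card ≤ d := by
  obtain ⟨p, hpn, hp⟩ := hS
  have hanc : ∀ v ∈ tops R S, ∀ u, R u v ↔ u < n ∧ Ge R u p := by
    intro v hv u
    rw [mem_tops] at hv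
    rw [(hp v hv.1).2 u, or_iff_right]
    rintro ⟨hu, huv⟩
    exact hv.2 u hu huv
  rcases lt_or_ge p n with hpn' | hpn'
  · refine hd.children p _ fun v hv => ⟨(hanc v hv p).2 ⟨hpn', Ge.refl _⟩, fun z ⟨hpz, hzv⟩ => ?_⟩
    exact h.not_ge hpz ((hanc v hv z).1 hzv).2
  · refine hd.roots _ fun v hv => ⟨hSn v (mem_tops.1 hv).1, fun u huv => ?_⟩
    obtain ⟨h1, h2 | h2⟩ := (hanc v hv u).1 huv
    · omega
    · have := (hn _ _ h2).2
      omega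

/-- Elements just below `c` within `S` are children of `c` in the whole forest: an intermediate
element outside `S` would be `≽ p` and thus above `c`, giving a cycle. -/
theorem Closed.tops_below_le {par : ℕ → ℕ} {S B : Finset ℕ} {c d : ℕ} (h : IsForest R)
    (hd : DegreeLe R n d) (hS : Closed R n par S) (hc : c ∈ S)
    (hB : ∀ s, s ∈ B ↔ s ∈ S ∧ R c s) : (tops R B).card ≤ d := by
  obtain ⟨p, hpn, hp⟩ := hS
  refine hd.children c _ fun v hv => ?_
  rw [mem_tops, hB] at hv
  refine ⟨hv.1.2, fun z ⟨hcz, hzv⟩ => ?_⟩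
  rcases ((hp v hv.1.1).2 z).1 hzv with ⟨hz, _⟩ | ⟨hz, hzp⟩
  · exact hv.2 z ((hB z).2 ⟨hz, hcz⟩) hzv
  · exact h.irrefl c (h.trans _ _ _ hcz (((hp c hc).2 z).2 (Or.inr ⟨hz, hzp⟩)))

end Segments

/-! ### The potential -/

/-- The function `t ↦ t log t` on natural numbers. -/
noncomputable def xlog (t : ℕ) : ℝ := t * Real.log t

theorem xlog_nonneg (t : ℕ) : 0 ≤ xlog t :=
  mul_nonneg (Nat.cast_nonneg _) (Real.log_natCast_nonneg _)

/-- As `2k ≤ k + l`, each of the `k` elements of the smaller part loses at least `log 2 > 1/2` in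
its logarithm; those of the other part lose at least 0. -/
theorem xlog_split_aux {k l : ℕ} (hk : 0 < k) (hkl : k ≤ l) :
    xlog k + xlog l + k / 2 ≤ xlog (k + l) := by
  have hk' : (0 : ℝ) < k := Nat.cast_pos.2 hk
  have hl' : (0 : ℝ) < l := Nat.cast_pos.2 (hk.trans_le hkl)
  have hkl' : (k : ℝ) ≤ l := Nat.cast_le.2 hkl
  have h1 : Real.log k + Real.log 2 ≤ Real.log (k + l) := by
    rw [← Real.log_mul hk'.ne' two_ne_zero]
    exact Real.log_le_log (by positivity) (by linarith)
  have h2 : Real.log l ≤ Real.log (k + l) := Real.log_le_log hl' (by linarith)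
  have h3 := Real.log_two_gt_d9
  unfold xlog
  push_cast
  nlinarith [mul_le_mul_of_nonneg_left h1 hk'.le, mul_le_mul_of_nonneg_left h2 hl'.le,
    mul_le_mul_of_nonneg_left h3.le hk'.le]

theorem xlog_split {k m : ℕ} (hk : k ≤ m) :
    xlog k + xlog (m - k) + (min k (m - k) : ℕ) / 2 ≤ xlog m := by
  obtain ⟨l, rfl⟩ := Nat.exists_eq_add_of_le hk
  rw [Nat.add_sub_cancel_left]
  rcases Nat.eq_zero_or_pos k with rfl | hk0
  · simp [xlog]
  rcases Nat.eq_zero_or_pos l with rfl | hl0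
  · simp [xlog]
  rcases le_total k l with h | h
  · rw [min_eq_left h]
    exact xlog_split_aux hk0 h
  · rw [min_eq_right h, add_comm (xlog k), add_comm k]
    exact xlog_split_aux hl0 h

/-- The bound of `random_cut` is averaged through `xlog_split`; the 512 is `2 · 256`, with the 2
from the half in the split. Divided by `512 d |S|²`, it says that the expected drop is at least `|S|
/ (512 d)`. -/
theorem expected_xlog {α : Type*} {R : α → α → Prop} (h : IsForest R) {S : Finset α} {d : ℕ}
    (hS : 2 ≤ S.card)
    (hd : (tops R S).card ≤ d) (hd' : ∀ c ∈ S, ∀ B : Finset α,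
      (∀ s, s ∈ B ↔ s ∈ S ∧ R c s) → (tops R B).card ≤ d) :
    512 * d * (∑ x ∈ S, ∑ y ∈ S, (xlog (cutSet R S x y).card +
      xlog (S.card - (cutSet R S x y).card))) + S.card ^ 3 ≤
      512 * d * (S.card ^ 2 * xlog S.card) := by
  have h1 : ((S.card ^ 3 : ℕ) : ℝ) ≤ _ := Nat.cast_le.2 (random_cut h hS hd hd')
  push_cast at h1
  have h2 : ∑ x ∈ S, ∑ y ∈ S, ((xlog (cutSet R S x y).card +
      xlog (S.card - (cutSet R S x y).card)) +
        ((min (cutSet R S x y).card (S.card - (cutSet R S x y).card) : ℕ) : ℝ) / 2) ≤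
      ∑ x ∈ S, ∑ y ∈ S, xlog S.card :=
    Finset.sum_le_sum fun x _ => Finset.sum_le_sum fun y _ =>
      xlog_split (Finset.card_le_card fun s hs => (mem_cutSet.1 hs).1)
  simp only [Finset.sum_add_distrib, Finset.sum_const, nsmul_eq_mul, ← Finset.sum_div] at h2
  push_cast at h2
  simp only [Finset.sum_add_distrib]
  have hd0 : (0 : ℝ) ≤ d := Nat.cast_nonneg d
  have h3 := mul_le_mul_of_nonneg_left h2 (by positivity : (0 : ℝ) ≤ 512 * d)
  nlinarith

/-! ### The sorting program

Registers: `0` the number `n` of elements, `1` and `2` the ends of the current segment, `3` the loop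
counter, `4`, `5`, `6`, `7`, `8` elements (`x`, `y`, `z`, the parent of `z`, the current one), `10`
the number `1`, `11` the place of the cut, `13` the length of the segment minus one, `14` the
number `0`, `15` the number `n + 1`, and `9`, `12` auxiliary registers.

Arrays: `0` the elements in their current order, `1` the ends of the segments (at their starts),
`2` the parents, `3` the sizes of the subtrees, `4` the offsets within the subtree of the parent,
`5` and `6` the intervals that represent the tree. -/

/-- Sequential composition of a list of programs. -/
def block : List Cmd → Cmd
  | [] => .skip
  | p :: l => .seq p (block l)

/-- `x := 1` if the element in `i` dominates or equals the element in `j`. -/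
def geq (x i j : ℕ) : Cmd := .ite (.eq i j) (.const x 1) (.query x i j)

/-- The body of the loop that finds the highest element `z` that is `≽ x` but not `≽ y`. -/
def topBody : Cmd := block [.load 8 0 3, geq 9 8 6,
  .ite (.eq 9 10) (block [geq 9 8 5, .ite (.eq 9 10) .skip (.copy 6 8)]) .skip, .succ 3 3]

/-- The body of the loop that finds the parent of `z`. -/
def parentBody : Cmd := block [.load 8 0 3, .query 9 8 6,
  .ite (.eq 9 10) (block [.query 9 8 7, .ite (.eq 9 10) .skip (.copy 7 8)]) .skip, .succ 3 3]

/-- The body of the loop that moves the elements below `z` to the end of the segment. -/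
def cutBody : Cmd := block [.load 8 0 3, geq 9 6 8,
  .ite (.eq 9 10) (.store 2 8 7)
    (block [.load 12 0 11, .store 0 11 8, .store 0 3 12, .succ 11 11]), .succ 3 3]

/-- The body of the loop that fills the arrays at the beginning. -/
def initBody : Cmd := block [.store 0 3 3, .store 2 3 0, .store 3 3 10, .succ 3 3]

/-- The body of the loop that computes the sizes of the subtrees and the offsets. -/
def offsetBody : Cmd := block [.sub 3 3 10, .load 8 0 3, .load 7 2 8, .load 4 3 7, .load 5 3 8,
  .store 4 8 4, .sub 9 15 4, .sub 9 9 5, .sub 9 15 9, .store 3 7 9]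

/-- The body of the loop that computes the intervals. -/
def intervalBody : Cmd := block [.load 8 0 3, .load 7 2 8, .load 4 5 7, .load 5 4 8,
  .sub 9 15 4, .sub 9 9 5, .sub 9 15 9, .store 5 8 9, .load 5 3 8,
  .sub 4 15 9, .sub 4 4 5, .sub 4 15 4, .store 6 8 4, .succ 3 3]

/-- The value that `geq` computes. -/
def geVal (O : ℕ → ℕ → ℕ) (i j : ℕ) : ℕ := if i = j then 1 else O i j

theorem exec_geq (O : ℕ → ℕ → ℕ) (x i j : ℕ) (m : Mem) :
    (geq x i j).exec O m = m.setReg x (geVal O (m.reg i) (m.reg j)) := by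
  by_cases h : m.reg i = m.reg j <;> simp [geq, Cmd.exec, Test.eval, geVal, h]

theorem geVal_eq_one {R : ℕ → ℕ → Prop} {O : ℕ → ℕ → ℕ} (hO : ∀ i j, O i j = 1 ↔ R i j)
    (i j : ℕ) : geVal O i j = 1 ↔ Ge R i j := by
  by_cases h : i = j <;> simp [geVal, Ge, h, hO]

theorem exec_topBody (O : ℕ → ℕ → ℕ) (m : Mem) (h10 : m.reg 10 = 1) :
    (topBody.exec O m).arr = m.arr ∧ (topBody.exec O m).reg 3 = m.reg 3 + 1 ∧
    (∀ x ∈ ([0, 1, 2, 5, 10] : List ℕ), (topBody.exec O m).reg x = m.reg x) ∧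
    (topBody.exec O m).reg 6 =
      if geVal O (m.arr 0 (m.reg 3)) (m.reg 6) = 1 ∧ ¬ geVal O (m.arr 0 (m.reg 3)) (m.reg 5) = 1
      then m.arr 0 (m.reg 3) else m.reg 6 := by
  simp only [topBody, block, Cmd.exec, exec_geq, Test.eval, Mem.setReg, Function.update_apply]
  by_cases h1 : geVal O (m.arr 0 (m.reg 3)) (m.reg 6) = 1 <;>
  by_cases h2 : geVal O (m.arr 0 (m.reg 3)) (m.reg 5) = 1 <;>
  simp [h1, h2, h10]

theorem exec_parentBody (O : ℕ → ℕ → ℕ) (m : Mem) (h10 : m.reg 10 = 1) :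
    (parentBody.exec O m).arr = m.arr ∧ (parentBody.exec O m).reg 3 = m.reg 3 + 1 ∧
    (∀ x ∈ ([0, 1, 2, 6, 10] : List ℕ), (parentBody.exec O m).reg x = m.reg x) ∧
    (parentBody.exec O m).reg 7 =
      if O (m.arr 0 (m.reg 3)) (m.reg 6) = 1 ∧ ¬ O (m.arr 0 (m.reg 3)) (m.reg 7) = 1
      then m.arr 0 (m.reg 3) else m.reg 7 := by
  simp only [parentBody, block, Cmd.exec, Test.eval, Mem.setReg, Function.update_apply]
  by_cases h1 : O (m.arr 0 (m.reg 3)) (m.reg 6) = 1 <;>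
  by_cases h2 : O (m.arr 0 (m.reg 3)) (m.reg 7) = 1 <;>
  simp [h1, h2, h10]

theorem exec_cutBody (O : ℕ → ℕ → ℕ) (m : Mem) (h10 : m.reg 10 = 1) :
    (cutBody.exec O m).reg 3 = m.reg 3 + 1 ∧
    (∀ x ∈ ([0, 1, 2, 6, 7, 10] : List ℕ), (cutBody.exec O m).reg x = m.reg x) ∧
    (∀ a, a ≠ 0 → a ≠ 2 → (cutBody.exec O m).arr a = m.arr a) ∧
    (geVal O (m.reg 6) (m.arr 0 (m.reg 3)) = 1 →
      (cutBody.exec O m).reg 11 = m.reg 11 ∧ (cutBody.exec O m).arr 0 = m.arr 0 ∧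
      (cutBody.exec O m).arr 2 = Function.update (m.arr 2) (m.arr 0 (m.reg 3)) (m.reg 7)) ∧
    (¬ geVal O (m.reg 6) (m.arr 0 (m.reg 3)) = 1 →
      (cutBody.exec O m).reg 11 = m.reg 11 + 1 ∧
      (cutBody.exec O m).arr 0 = (fun k => m.arr 0 (Equiv.swap (m.reg 11) (m.reg 3) k)) ∧
      (cutBody.exec O m).arr 2 = m.arr 2) := by
  simp only [cutBody, block, Cmd.exec, exec_geq, Test.eval, Mem.setReg, Mem.setArr,
    Function.update_apply]
  by_cases h1 : geVal O (m.reg 6) (m.arr 0 (m.reg 3)) = 1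
  · simp [h1, h10]
    exact fun a h0 h2 => by simp [h2]
  · simp [h1, h10]
    refine ⟨fun a h0 h2 => by simp [h0], ?_⟩
    funext k
    simp only [Function.update_apply, Equiv.swap_apply_def]
    split_ifs <;> simp_all

theorem exec_initBody (O : ℕ → ℕ → ℕ) (m : Mem) :
    (initBody.exec O m).reg 3 = m.reg 3 + 1 ∧
    (∀ x, x ≠ 3 → (initBody.exec O m).reg x = m.reg x) ∧
    (initBody.exec O m).arr 0 = Function.update (m.arr 0) (m.reg 3) (m.reg 3) ∧
    (initBody.exec O m).arr 2 = Function.update (m.arr 2) (m.reg 3) (m.reg 0) ∧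
    (initBody.exec O m).arr 3 = Function.update (m.arr 3) (m.reg 3) (m.reg 10) := by
  simp [initBody, block, Cmd.exec, Mem.setReg, Mem.setArr, Function.update_apply]
  intro x hx h; exact absurd h hx

/-- The machine has no addition. With `M = n + 1` in register 15, the sum `s + t` is computed as `M
- (M - s - t)`, which is correct for `s + t ≤ M`; this is why bounds by `n + 1` accompany sizes and
intervals. -/
theorem exec_offsetBody (O : ℕ → ℕ → ℕ) (m : Mem) {v p q : ℕ} (h10 : m.reg 10 = 1)
    (hq : m.reg 3 = q + 1)
    (hv : m.arr 0 q = v) (hp : m.arr 2 v = p) (hle : m.arr 3 p + m.arr 3 v ≤ m.reg 15) :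
    (offsetBody.exec O m).reg 3 = q ∧
    (∀ x ∈ ([0, 10, 14, 15] : List ℕ), (offsetBody.exec O m).reg x = m.reg x) ∧
    (∀ a, a ≠ 3 → a ≠ 4 → (offsetBody.exec O m).arr a = m.arr a) ∧
    (offsetBody.exec O m).arr 3 = Function.update (m.arr 3) p (m.arr 3 p + m.arr 3 v) ∧
    (offsetBody.exec O m).arr 4 = Function.update (m.arr 4) v (m.arr 3 p) := by
  have hadd : m.reg 15 - (m.reg 15 - m.arr 3 p - m.arr 3 v) = m.arr 3 p + m.arr 3 v := by omega
  simp [offsetBody, block, Cmd.exec, Mem.setReg, Mem.setArr, Function.update_apply, h10, hq, hv,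
    hp, hadd]
  exact fun a h3 h4 => by simp [h3, h4]

theorem exec_intervalBody (O : ℕ → ℕ → ℕ) (m : Mem) {v p : ℕ}
    (hv : m.arr 0 (m.reg 3) = v) (hp : m.arr 2 v = p)
    (hle : m.arr 5 p + m.arr 4 v + m.arr 3 v ≤ m.reg 15) :
    (intervalBody.exec O m).reg 3 = m.reg 3 + 1 ∧
    (∀ x ∈ ([0, 10, 14, 15] : List ℕ), (intervalBody.exec O m).reg x = m.reg x) ∧
    (∀ a, a ≠ 5 → a ≠ 6 → (intervalBody.exec O m).arr a = m.arr a) ∧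
    (intervalBody.exec O m).arr 5 = Function.update (m.arr 5) v (m.arr 5 p + m.arr 4 v) ∧
    (intervalBody.exec O m).arr 6 =
      Function.update (m.arr 6) v (m.arr 5 p + m.arr 4 v + m.arr 3 v) := by
  have hadd : m.reg 15 - (m.reg 15 - m.arr 5 p - m.arr 4 v) = m.arr 5 p + m.arr 4 v := by omega
  have hadd' : m.reg 15 - (m.reg 15 - (m.arr 5 p + m.arr 4 v) - m.arr 3 v) =
      m.arr 5 p + m.arr 4 v + m.arr 3 v := by omega
  simp [intervalBody, block, Cmd.exec, Mem.setReg, Mem.setArr, Function.update_apply, hv,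
    hp, hadd, hadd']
  exact fun a h3 h4 => by simp [h3, h4]

theorem mem_seg_succ {ord : ℕ → ℕ} {a j s : ℕ} (hs : ord (a + j) = s) {t : ℕ} :
    t ∈ seg ord a (a + (j + 1)) ↔ t ∈ seg ord a (a + j) ∨ t = s := by
  subst hs
  rw [mem_seg, mem_seg]
  constructor
  · rintro ⟨i, hi, rfl⟩
    rcases Nat.lt_or_ge i (a + j) with h1 | h1
    · exact Or.inl ⟨i, ⟨hi.1, h1⟩, rfl⟩
    · obtain rfl : i = a + j := by omega
      exact Or.inr rfl
  · rintro (⟨i, hi, rfl⟩ | rfl)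
    · exact ⟨i, ⟨hi.1, by omega⟩, rfl⟩
    · exact ⟨a + j, ⟨by omega, by omega⟩, rfl⟩

/-! ### The three scans of a segment that perform a cut -/

section Loops

variable {R : ℕ → ℕ → Prop} {n : ℕ} {O : ℕ → ℕ → ℕ}

/-- The elements that are `≽ x` and not `≽ y` form a chain, so one pass that keeps the highest one
seen suffices. The candidate starts at `x` itself. -/
theorem topLoop (h : IsForest R) (hO : ∀ i j, O i j = 1 ↔ R i j) {m : Mem} {a b : ℕ} (hab : a ≤ b)
    (h2 : m.reg 2 = b) (h3 : m.reg 3 = a) (h10 : m.reg 10 = 1)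
    (hx : m.reg 6 ∈ seg (m.arr 0) a b) (hy : ¬ Ge R (m.reg 6) (m.reg 5)) :
    ∃ m', (m'.arr = m.arr ∧ (∀ x ∈ ([0, 1, 2, 5, 10] : List ℕ), m'.reg x = m.reg x) ∧
      m'.reg 6 ∈ seg (m.arr 0) a b ∧ Ge R (m'.reg 6) (m.reg 6) ∧ ¬ Ge R (m'.reg 6) (m.reg 5) ∧
      ∀ s ∈ seg (m.arr 0) a b, Ge R s (m.reg 6) → ¬ Ge R s (m.reg 5) → Ge R (m'.reg 6) s) ∧
      ∀ k, Reaches O ((b - a) * (topBody.weight + 1) + 1) (.while (.lt 3 2) topBody :: k, m)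
        (k, m') := by
  obtain ⟨m', hI, hr⟩ := while_reaches (O := O) (b := .lt 3 2) (p := topBody) (m := m)
    (by simp [topBody, block, geq, Cmd.LoopFree])
    (fun j m' => (m'.arr = m.arr ∧ m'.reg 3 = a + j ∧
      (∀ x ∈ ([0, 1, 2, 5, 10] : List ℕ), m'.reg x = m.reg x)) ∧
      m'.reg 6 ∈ seg (m.arr 0) a b ∧ Ge R (m'.reg 6) (m.reg 6) ∧ ¬ Ge R (m'.reg 6) (m.reg 5) ∧
      ∀ s ∈ seg (m.arr 0) a (a + j), Ge R s (m.reg 6) → ¬ Ge R s (m.reg 5) →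
        Ge R (m'.reg 6) s) (b - a)
    (by
      rintro j hj m' ⟨⟨hA, hr3, hreg⟩, hz, hzx, hzy, hmax⟩
      simp only [List.mem_cons, List.not_mem_nil, or_false, forall_eq_or_imp, forall_eq] at hreg
      obtain ⟨e0, e1, e2, e5, e10⟩ := hreg
      refine ⟨by simp [Test.eval, hr3, e2, h2]; omega, ?_⟩
      set s := m.arr 0 (a + j) with hs
      have hsm : s ∈ seg (m.arr 0) a b := mem_seg.2 ⟨a + j, ⟨by omega, by omega⟩, rfl⟩
      obtain ⟨f1, f2, f3, f4⟩ := exec_topBody O m' (e10.trans h10)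
      rw [hr3, hA, ← hs, e5] at f4
      refine ⟨⟨f1.trans hA, by rw [f2, hr3]; omega, fun x hx => ?_⟩, ?_⟩
      · rw [f3 x hx]
        simp only [List.mem_cons, List.not_mem_nil, or_false] at hx
        rcases hx with rfl | rfl | rfl | rfl | rfl <;> assumption
      · rw [f4]
        split_ifs with hif <;> rw [geVal_eq_one hO, geVal_eq_one hO] at hif
        · refine ⟨hsm, h.ge_trans hif.1 hzx, hif.2, fun t ht htx hty => ?_⟩
          rcases (mem_seg_succ rfl).1 ht with ht | rfl
          · exact h.ge_trans hif.1 (hmax t ht htx hty)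
          · exact Ge.refl _
        · refine ⟨hz, hzx, hzy, fun t ht htx hty => ?_⟩
          rcases (mem_seg_succ rfl).1 ht with ht | rfl
          · exact hmax t ht htx hty
          · rcases h.ge_chain hzx htx with h1 | h1
            · exact h1
            · exact absurd ⟨Or.inr h1, hty⟩ hif)
    (by
      rintro m' ⟨⟨hA, hr3, hreg⟩, -⟩
      have e2 := hreg 2 (by simp)
      simp [Test.eval, hr3, e2, h2]; omega)
    ⟨⟨rfl, h3, fun _ _ => rfl⟩, hx, Ge.refl _, hy, by simp [seg]⟩
  refine ⟨m', ⟨hI.1.1, hI.1.2.2, hI.2.1, hI.2.2.1, hI.2.2.2.1, ?_⟩, hr⟩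
  have := hI.2.2.2.2
  rwa [Nat.add_sub_cancel' hab] at this

theorem parentLoop (h : IsForest R) (hn : ∀ u v, R u v → u < n ∧ v < n)
    (hO : ∀ i j, O i j = 1 ↔ R i j) {m : Mem} {a b : ℕ} (hab : a ≤ b)
    (h2 : m.reg 2 = b) (h3 : m.reg 3 = a) (h10 : m.reg 10 = 1)
    (hz : m.reg 6 ∈ seg (m.arr 0) a b) (hcl : Closed R n (m.arr 2) (seg (m.arr 0) a b))
    (hw : m.reg 7 = m.arr 2 (m.reg 6)) :
    ∃ m', (m'.arr = m.arr ∧ (∀ x ∈ ([0, 1, 2, 6, 10] : List ℕ), m'.reg x = m.reg x) ∧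
      IsParent R (m.arr 2) (seg (m.arr 0) a b) (m.reg 6) (m'.reg 7)) ∧
      ∀ k, Reaches O ((b - a) * (parentBody.weight + 1) + 1) (.while (.lt 3 2) parentBody :: k, m)
        (k, m') := by
  obtain ⟨m', hI, hr⟩ := while_reaches (O := O) (b := .lt 3 2) (p := parentBody) (m := m)
    (by simp [parentBody, block, Cmd.LoopFree])
    (fun j m' => (m'.arr = m.arr ∧ m'.reg 3 = a + j ∧
      (∀ x ∈ ([0, 1, 2, 6, 10] : List ℕ), m'.reg x = m.reg x)) ∧
      ((m'.reg 7 = m.arr 2 (m.reg 6) ∧ ∀ s ∈ seg (m.arr 0) a (a + j), ¬ R s (m.reg 6)) ∨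
        (m'.reg 7 ∈ seg (m.arr 0) a b ∧ R (m'.reg 7) (m.reg 6) ∧
          ∀ s ∈ seg (m.arr 0) a (a + j), R s (m.reg 6) → Ge R s (m'.reg 7)))) (b - a)
    (by
      rintro j hj m' ⟨⟨hA, hr3, hreg⟩, hpar⟩
      simp only [List.mem_cons, List.not_mem_nil, or_false, forall_eq_or_imp, forall_eq] at hreg
      obtain ⟨e0, e1, e2, e6, e10⟩ := hreg
      refine ⟨by simp [Test.eval, hr3, e2, h2]; omega, ?_⟩
      set s := m.arr 0 (a + j) with hs
      have hsm : s ∈ seg (m.arr 0) a b := mem_seg.2 ⟨a + j, ⟨by omega, by omega⟩, rfl⟩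
      obtain ⟨f1, f2, f3, f4⟩ := exec_parentBody O m' (e10.trans h10)
      rw [hr3, hA, ← hs, e6] at f4
      refine ⟨⟨f1.trans hA, by rw [f2, hr3]; omega, fun x hx => ?_⟩, ?_⟩
      · rw [f3 x hx]
        simp only [List.mem_cons, List.not_mem_nil, or_false] at hx
        rcases hx with rfl | rfl | rfl | rfl | rfl <;> assumption
      · rw [f4]
        split_ifs with hif <;> rw [hO, hO] at hif
        · refine Or.inr ⟨hsm, hif.1, fun t ht htz => ?_⟩
          rcases (mem_seg_succ rfl).1 ht with ht | rfl
          · rcases hpar with ⟨_, hno⟩ | ⟨_, h1, h2⟩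
            · exact absurd htz (hno t ht)
            · refine h.ge_trans (h2 t ht htz) ?_
              rcases h.chain _ _ _ h1 hif.1 with h3 | h3 | h3
              · exact Or.inl h3
              · exact Or.inr h3
              · exact absurd h3 hif.2
          · exact Ge.refl _
        · rcases hpar with ⟨hw', hno⟩ | ⟨hwm, h1, h2⟩
          · refine Or.inl ⟨hw', fun t ht htz => ?_⟩
            rcases (mem_seg_succ rfl).1 ht with ht | rfl
            · exact hno t ht htz
            · refine hif ⟨htz, fun hsw => ?_⟩
              obtain ⟨p, hpn, hp⟩ := hcl
              rw [hw', (hp _ hz).1] at hsw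
              -- The candidate is still the old parent `p`, which lies above all of `S`. So an
              -- ancestor `s` of `z` in `S` cannot dominate it, and the first such `s` does replace
              -- it; for `p = n` no relation holds at all.
              have h4 := ((hp s hsm).2 p).2 (Or.inr ⟨(hn _ _ hsw).2, Ge.refl _⟩)
              exact h.irrefl _ (h.trans _ _ _ hsw h4)
          · refine Or.inr ⟨hwm, h1, fun t ht htz => ?_⟩
            rcases (mem_seg_succ rfl).1 ht with ht | rfl
            · exact h2 t ht htz
            · by_contra hcon
              exact hif ⟨htz, fun h3 => hcon (Or.inr h3)⟩)
    (by
      rintro m' ⟨⟨hA, hr3, hreg⟩, -⟩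
      have e2 := hreg 2 (by simp)
      simp [Test.eval, hr3, e2, h2]; omega)
    ⟨⟨rfl, h3, fun _ _ => rfl⟩, Or.inl ⟨hw, by simp [seg]⟩⟩
  refine ⟨m', ⟨hI.1.1, hI.1.2.2, ?_⟩, hr⟩
  have := hI.2
  rwa [Nat.add_sub_cancel' hab] at this

/-- An in-place partition: register 11 is the boundary behind the elements not below `z`, and the
rearrangement is recorded as a permutation composed of the swaps made so far. -/
theorem cutLoop (hO : ∀ i j, O i j = 1 ↔ R i j) {m : Mem} {a b : ℕ} (hab : a ≤ b)
    (h2 : m.reg 2 = b) (h3 : m.reg 3 = a) (h10 : m.reg 10 = 1) (h11 : m.reg 11 = a) :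
    ∃ m', ((∀ x ∈ ([0, 1, 2, 6, 7, 10] : List ℕ), m'.reg x = m.reg x) ∧
      (∀ i, i ≠ 0 → i ≠ 2 → m'.arr i = m.arr i) ∧ ∃ π : Equiv.Perm ℕ,
      (∀ k, k < a ∨ b ≤ k → π k = k) ∧ m'.arr 0 = (fun k => m.arr 0 (π k)) ∧
      a ≤ m'.reg 11 ∧ m'.reg 11 ≤ b ∧
      (∀ k, a ≤ k → k < m'.reg 11 → ¬ Ge R (m.reg 6) (m.arr 0 (π k))) ∧
      (∀ k, m'.reg 11 ≤ k → k < b → Ge R (m.reg 6) (m.arr 0 (π k))) ∧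
      (∀ v ∈ down R (seg (m.arr 0) a b) (m.reg 6), m'.arr 2 v = m.reg 7) ∧
      (∀ v, v ∉ down R (seg (m.arr 0) a b) (m.reg 6) → m'.arr 2 v = m.arr 2 v)) ∧
      ∀ k, Reaches O ((b - a) * (cutBody.weight + 1) + 1) (.while (.lt 3 2) cutBody :: k, m)
        (k, m') := by
  obtain ⟨m', hI, hr⟩ := while_reaches (O := O) (b := .lt 3 2) (p := cutBody) (m := m)
    (by simp [cutBody, block, geq, Cmd.LoopFree])
    (fun j m' => (m'.reg 3 = a + j ∧
      (∀ x ∈ ([0, 1, 2, 6, 7, 10] : List ℕ), m'.reg x = m.reg x) ∧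
      (∀ i, i ≠ 0 → i ≠ 2 → m'.arr i = m.arr i)) ∧ ∃ π : Equiv.Perm ℕ,
      (∀ k, k < a ∨ a + j ≤ k → π k = k) ∧ m'.arr 0 = (fun k => m.arr 0 (π k)) ∧
      a ≤ m'.reg 11 ∧ m'.reg 11 ≤ a + j ∧
      (∀ k, a ≤ k → k < m'.reg 11 → ¬ Ge R (m.reg 6) (m.arr 0 (π k))) ∧
      (∀ k, m'.reg 11 ≤ k → k < a + j → Ge R (m.reg 6) (m.arr 0 (π k))) ∧
      (∀ v ∈ down R (seg (m.arr 0) a (a + j)) (m.reg 6), m'.arr 2 v = m.reg 7) ∧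
      (∀ v, v ∉ down R (seg (m.arr 0) a (a + j)) (m.reg 6) → m'.arr 2 v = m.arr 2 v)) (b - a)
    (by
      rintro j hj m' ⟨⟨hr3, hreg, hA⟩, π, hπ, hA0, hc1, hc2, hlow, hhigh, hd, hd'⟩
      have hreg' := hreg
      simp only [List.mem_cons, List.not_mem_nil, or_false, forall_eq_or_imp, forall_eq] at hreg
      obtain ⟨e0, e1, e2, e6, e7, e10⟩ := hreg
      refine ⟨by simp [Test.eval, hr3, e2, h2]; omega, ?_⟩
      have hs : m'.arr 0 (a + j) = m.arr 0 (a + j) := by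
        simp only [hA0, hπ (a + j) (Or.inr le_rfl)]
      obtain ⟨f1, f2, f3, f4, f5⟩ := exec_cutBody O m' (e10.trans h10)
      rw [hr3, hs, e6, geVal_eq_one hO] at f4 f5
      have hπj := hπ (a + j) (Or.inr le_rfl)
      refine ⟨⟨by rw [f1, hr3]; omega, fun x hx => (f2 x hx).trans (hreg' x hx),
        fun i h0 h2 => (f3 i h0 h2).trans (hA i h0 h2)⟩, ?_⟩
      by_cases hge : Ge R (m.reg 6) (m.arr 0 (a + j))
      · obtain ⟨g1, g2, g3⟩ := f4 hge
        rw [g1, g2, g3, e7]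
        refine ⟨π, fun k hk => hπ k (by omega), hA0, hc1, by omega, hlow, fun k h4 h5 => ?_,
          fun v hv => ?_, fun v hv => ?_⟩
        · rcases Nat.lt_or_ge k (a + j) with h6 | h6
          · exact hhigh k h4 h6
          · obtain rfl : k = a + j := by omega
            rwa [hπj]
        · rw [Function.update_apply]
          split_ifs with hif
          · rfl
          · rw [mem_down, mem_seg_succ rfl] at hv
            exact hd v (mem_down.2 ⟨hv.1.resolve_right hif, hv.2⟩)
        · rw [mem_down, mem_seg_succ rfl] at hv
          rw [Function.update_of_ne, hd']
          · exact fun hv' => hv ⟨Or.inl (mem_down.1 hv').1, (mem_down.1 hv').2⟩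
          · rintro rfl
            exact hv ⟨Or.inr rfl, hge⟩
      · obtain ⟨g1, g2, g3⟩ := f5 hge
        rw [g1, g2, g3]
        have hdd : ∀ v, v ∈ down R (seg (m.arr 0) a (a + (j + 1))) (m.reg 6) ↔
            v ∈ down R (seg (m.arr 0) a (a + j)) (m.reg 6) := by
          intro v
          rw [mem_down, mem_down, mem_seg_succ rfl]
          constructor
          · rintro ⟨h4 | rfl, h5⟩
            · exact ⟨h4, h5⟩
            · exact absurd h5 hge
          · exact fun h4 => ⟨Or.inl h4.1, h4.2⟩
        -- The new element goes to the boundary, and the first element of the upper block moves to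
        -- the end of that block. If the block is empty, the swap is the identity.
        refine ⟨(Equiv.swap (m'.reg 11) (a + j)).trans π, fun k hk => ?_, ?_, by omega, by omega,
          fun k h4 h5 => ?_, fun k h4 h5 => ?_, fun v hv => hd v ((hdd v).1 hv),
          fun v hv => hd' v fun h4 => hv ((hdd v).2 h4)⟩
        · rw [Equiv.trans_apply, Equiv.swap_apply_of_ne_of_ne (by omega) (by omega)]
          exact hπ k (by omega)
        · funext k
          rw [hA0]
          rfl
        · rw [Equiv.trans_apply]
          rcases Nat.lt_or_ge k (m'.reg 11) with h6 | h6
          · rw [Equiv.swap_apply_of_ne_of_ne (by omega) (by omega)]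
            exact hlow k h4 h6
          · obtain rfl : k = m'.reg 11 := by omega
            rwa [Equiv.swap_apply_left, hπj]
        · rw [Equiv.trans_apply]
          rcases Nat.lt_or_ge k (a + j) with h6 | h6
          · rw [Equiv.swap_apply_of_ne_of_ne (by omega) (by omega)]
            exact hhigh k (by omega) h6
          · obtain rfl : k = a + j := by omega
            rw [Equiv.swap_apply_right]
            exact hhigh _ le_rfl (by omega))
    (by
      rintro m' ⟨⟨hr3, hreg, -⟩, -⟩
      have e2 := hreg 2 (by simp)
      simp [Test.eval, hr3, e2, h2]; omega)
    ⟨⟨h3, fun _ _ => rfl, fun _ _ _ => rfl⟩, 1, by simp, by simp, h11.ge, h11.le,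
      fun k h4 h5 => by omega, fun k h4 h5 => by omega, by simp [seg, down], fun _ _ => rfl⟩
  refine ⟨m', ⟨hI.1.2.1, hI.1.2.2, ?_⟩, hr⟩
  have := hI.2
  rwa [Nat.add_sub_cancel' hab] at this

end Loops
/-! ### From parents to intervals -/

section Intervals

variable {R : ℕ → ℕ → Prop} {n : ℕ}

/-- Every element comes after its parent; roots have the parent `n`. -/
def ParentsFirst (n : ℕ) (ord par : ℕ → ℕ) : Prop :=
  ∀ i < n, par (ord i) = n ∨ ∃ j < i, ord j = par (ord i)

theorem exists_position {ord : ℕ → ℕ} (hinj : Set.InjOn ord (Set.Iio n))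
    (hlt : ∀ i < n, ord i < n) {v : ℕ} (hv : v < n) : ∃ i < n, ord i = v := by
  have h := Finset.surj_on_of_inj_on_of_card_le (s := Finset.range n) (t := Finset.range n)
    (fun i _ => ord i) (fun i hi => by simpa using hlt i (by simpa using hi))
    (fun i j hi hj hij => hinj (by simpa using hi) (by simpa using hj) hij) le_rfl v
    (by simpa using hv)
  obtain ⟨i, hi, hiv⟩ := h
  exact ⟨i, by simpa using hi, hiv.symm⟩

theorem Settled.parentsFirst {ord par : ℕ → ℕ} (hinj : Set.InjOn ord (Set.Iio n))
    (hlt : ∀ i < n, ord i < n) (hs : Settled R n ord par n) : ParentsFirst n ord par := by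
  intro i hi
  obtain ⟨h1, h2, h3⟩ := hs i hi
  rcases h1.lt_or_eq with h4 | h4
  · right
    obtain ⟨j, hj, hjv⟩ := exists_position hinj hlt h4
    refine ⟨j, h3 j hj ?_, hjv⟩
    rw [hjv]
    exact (h2 _).2 ⟨h4, Ge.refl _⟩
  · exact Or.inl h4

/-- The sizes `A` and the offsets `F` are correct for the positions from `q` on. -/
structure Offsets (n : ℕ) (ord par A F : ℕ → ℕ) (q : ℕ) : Prop where
  pos : ∀ u ≤ n, 1 ≤ A u
  nested : ∀ i, q ≤ i → i < n → 1 ≤ F (ord i) ∧ F (ord i) + A (ord i) ≤ A (par (ord i))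
  disjoint : ∀ i j, q ≤ i → i < j → j < n → par (ord i) = par (ord j) →
    F (ord j) + A (ord j) ≤ F (ord i)
  total : ∑ u ∈ insert n ((Finset.range q).image ord), A u ≤ n + 1

theorem Offsets.le_total {ord par A F : ℕ → ℕ} {q : ℕ} (h : Offsets n ord par A F q) :
    A n ≤ n + 1 :=
  (Finset.single_le_sum (f := A) (fun _ _ => Nat.zero_le _)
    (Finset.mem_insert_self n _)).trans h.total

/-- The subtree of `v` receives the next free place inside that of its parent, behind those of the
siblings already handled. The size of `v` leaves the sum over pending elements and is added to the
parent, which is pending or `n`; so the total is preserved. -/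
theorem Offsets.step {ord par A F : ℕ → ℕ} {q : ℕ} (h : Offsets n ord par A F (q + 1))
    (hinj : Set.InjOn ord (Set.Iio n)) (hlt : ∀ i < n, ord i < n) (hp : ParentsFirst n ord par)
    (hq : q < n) :
    A (par (ord q)) + A (ord q) ≤ n + 1 ∧
    Offsets n ord par (Function.update A (par (ord q)) (A (par (ord q)) + A (ord q)))
      (Function.update F (ord q) (A (par (ord q)))) q := by
  set v := ord q with hv
  set p := par v with hpdef
  have hpq : p = n ∨ ∃ j < q, ord j = p := hp q hq
  have hvn : v < n := hlt q hq
  -- Parents come first, so going backwards all children of an element are handled before it, and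
  -- the size of a handled element never changes again.
  have hne : ∀ i, q ≤ i → i < n → ord i ≠ p := by
    intro i h1 h2 h3
    rcases hpq with h4 | ⟨j, hj, h4⟩
    · have := hlt i h2
      omega
    · have := hinj (show i < n from h2) (show j < n by omega) (h3.trans h4.symm)
      omega
  have hvp : v ≠ p := hne q le_rfl hq
  have hpn : p ≤ n := by
    rcases hpq with h4 | ⟨j, hj, h4⟩
    · exact h4.le
    · exact h4 ▸ (hlt j (by omega)).le
  have hnv : ∀ i, q < i → i < n → ord i ≠ v := by
    intro i h1 h2 h3
    have := hinj (show i < n from h2) (show q < n from hq) h3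
    omega
  have hset : insert n ((Finset.range (q + 1)).image ord) =
      insert v (insert n ((Finset.range q).image ord)) := by
    rw [Finset.range_add_one, Finset.image_insert, Finset.insert_comm]
  have hvnot : v ∉ insert n ((Finset.range q).image ord) := by
    rw [Finset.mem_insert, Finset.mem_image]
    rintro (h1 | ⟨i, hi, h1⟩)
    · omega
    · rw [Finset.mem_range] at hi
      have := hinj (show i < n by omega) (show q < n from hq) h1
      omega
  have hpmem : p ∈ insert n ((Finset.range q).image ord) := by
    rw [Finset.mem_insert, Finset.mem_image]
    rcases hpq with h4 | ⟨j, hj, h4⟩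
    · exact Or.inl h4
    · exact Or.inr ⟨j, Finset.mem_range.2 hj, h4⟩
  have htot := h.total
  rw [hset, Finset.sum_insert hvnot] at htot
  have hple := Finset.single_le_sum (f := A) (fun _ _ => Nat.zero_le _) hpmem
  refine ⟨by omega, ⟨fun u hu => ?_, fun i h1 h2 => ?_, fun i j h1 h2 h3 h4 => ?_, ?_⟩⟩
  · rw [Function.update_apply]
    split_ifs
    · exact (h.pos p hpn).trans (Nat.le_add_right _ _)
    · exact h.pos u hu
  · rw [Function.update_of_ne (hne i h1 h2)]
    rcases h1.lt_or_eq with h5 | rfl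
    · rw [Function.update_of_ne (hnv i h5 h2)]
      obtain ⟨h6, h7⟩ := h.nested i h5 h2
      refine ⟨h6, h7.trans ?_⟩
      rw [Function.update_apply]
      split_ifs with h8
      · rw [h8]; exact Nat.le_add_right _ _
      · exact le_rfl
    · rw [← hv, ← hpdef, Function.update_self, Function.update_self]
      exact ⟨h.pos p hpn, le_rfl⟩
  · rw [Function.update_of_ne (hne j (by omega) h3), Function.update_of_ne (hnv j (by omega) h3)]
    rcases h1.lt_or_eq with h5 | rfl
    · rw [Function.update_of_ne (hnv i h5 (by omega))]
      exact h.disjoint i j h5 h2 h3 h4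
    · rw [← hv, Function.update_self]
      rw [← hv, ← hpdef] at h4
      rw [h4]
      exact (h.nested j h2 h3).2
  · have hsum := Finset.sum_update_of_mem hpmem A (A p + A v)
    rw [hsum]
    have hsum' := Finset.add_sum_erase _ A hpmem
    rw [Finset.sdiff_singleton_eq_erase]
    omega

/-- The numbers `P` and `E` are the correct ends of the intervals for the positions below `q`. -/
structure Intervals (n : ℕ) (ord par A F P E : ℕ → ℕ) (q : ℕ) : Prop where
  root : P n = 0
  start : ∀ i < q, P (ord i) = P (par (ord i)) + F (ord i)
  finish : ∀ i < q, E (ord i) = P (ord i) + A (ord i)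
  le : ∀ i < q, P (ord i) + A (ord i) ≤ n + 1

theorem Intervals.step {ord par A F P E : ℕ → ℕ} {q : ℕ} (h : Intervals n ord par A F P E q)
    (hoff : Offsets n ord par A F 0)
    (hinj : Set.InjOn ord (Set.Iio n)) (hlt : ∀ i < n, ord i < n) (hp : ParentsFirst n ord par)
    (hq : q < n) :
    P (par (ord q)) + F (ord q) + A (ord q) ≤ n + 1 ∧
    Intervals n ord par A F (Function.update P (ord q) (P (par (ord q)) + F (ord q)))
      (Function.update E (ord q) (P (par (ord q)) + F (ord q) + A (ord q))) (q + 1) := by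
  have hbound : P (par (ord q)) + F (ord q) + A (ord q) ≤ n + 1 := by
    have h1 := (hoff.nested q (Nat.zero_le _) hq).2
    have h2 : P (par (ord q)) + A (par (ord q)) ≤ n + 1 := by
      rcases hp q hq with h3 | ⟨j, hj, h3⟩
      · rw [h3, h.root]
        have := hoff.le_total
        omega
      · rw [← h3]; exact h.le j hj
    omega
  have hne : ∀ i < q, ord i ≠ ord q := by
    intro i hi h1
    have := hinj (show i < n by omega) (show q < n from hq) h1
    omega
  have hpar : ∀ i ≤ q, par (ord i) ≠ ord q := by
    intro i hi h1
    rcases hp i (by omega) with h3 | ⟨j, hj, h3⟩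
    · have := hlt q hq
      omega
    · exact hne j (by omega) (h3.trans h1)
  refine ⟨hbound, ⟨?_, fun i hi => ?_, fun i hi => ?_, fun i hi => ?_⟩⟩
  · rw [Function.update_of_ne (hlt q hq).ne', h.root]
  · rw [Function.update_of_ne (hpar i (by omega))]
    rcases Nat.lt_succ_iff_lt_or_eq.1 hi with h1 | rfl
    · rw [Function.update_of_ne (hne i h1), h.start i h1]
    · rw [Function.update_self]
  · rcases Nat.lt_succ_iff_lt_or_eq.1 hi with h1 | rfl
    · rw [Function.update_of_ne (hne i h1), Function.update_of_ne (hne i h1), h.finish i h1]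
    · rw [Function.update_self, Function.update_self]
  · rcases Nat.lt_succ_iff_lt_or_eq.1 hi with h1 | rfl
    · rw [Function.update_of_ne (hne i h1)]
      exact h.le i h1
    · rw [Function.update_self]
      exact hbound

/-- The intervals represent the tree. -/
theorem Intervals.correct {ord par A F P E : ℕ → ℕ} (h : IsForest R)
    (hn : ∀ u v, R u v → u < n ∧ v < n)
    (hI : Intervals n ord par A F P E n) (hoff : Offsets n ord par A F 0)
    (hinj : Set.InjOn ord (Set.Iio n)) (hlt : ∀ i < n, ord i < n) (hs : Settled R n ord par n)
    {u v : ℕ} (hu : u < n) (hv : v < n) : R u v ↔ P u < P v ∧ P v < E u := by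
  have hp := hs.parentsFirst hinj hlt
  have hA : ∀ i < n, 1 ≤ A (ord i) := fun i hi => hoff.pos _ (hlt i hi).le
  -- Induction up the parents. The inequality of left ends is strict since offsets are at least 1,
  -- the place `0` being taken by the parent itself.
  have nest : ∀ i < n, ∀ u, R u (ord i) →
      P u < P (ord i) ∧ P (ord i) + A (ord i) ≤ P u + A u := by
    intro i
    induction i using Nat.strong_induction_on with
    | _ i ih =>
      intro hi u hui
      have h1 := hI.start i hi
      obtain ⟨h2, h3⟩ := hoff.nested i (Nat.zero_le _) hi
      obtain ⟨hun, rfl | hup⟩ := ((hs i hi).2.1 u).1 hui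
      · omega
      · rcases hp i hi with h4 | ⟨j, hj, h4⟩
        · rw [h4] at hup
          have := (hn _ _ hup).2
          omega
        · rw [← h4] at hup
          have h5 := ih j hj (hj.trans hi) u hup
          rw [← h4] at h1 h3
          omega
  have branch : ∀ i < n, ∀ p, p = n ∨ R p (ord i) →
      ∃ k < n, par (ord k) = p ∧ Ge R (ord k) (ord i) := by
    intro i
    induction i using Nat.strong_induction_on with
    | _ i ih =>
      intro hi p hpi
      by_cases hpp : par (ord i) = p
      · exact ⟨i, hi, hpp, Ge.refl _⟩
      rcases hp i hi with h4 | ⟨j, hj, h4⟩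
      · exfalso
        rcases hpi with h5 | h5
        · exact hpp (h4.trans h5.symm)
        · have h6 := (((hs i hi).2.1 p).1 h5)
          rw [h4] at h6
          rcases h6.2 with h7 | h7
          · omega
          · have := (hn _ _ h7).2
            omega
      · have hji : R (ord j) (ord i) :=
          ((hs i hi).2.1 _).2 ⟨hlt j (hj.trans hi), Or.inl h4⟩
        have hanc' : ∀ u, R u (ord i) → Ge R u (ord j) := by
          intro u hu
          rw [h4]
          exact (((hs i hi).2.1 u).1 hu).2
        have hpj : p = n ∨ R p (ord j) := by
          rcases hpi with h5 | h5
          · exact Or.inl h5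
          · rcases hanc' p h5 with h6 | h6
            · exact absurd (h4.symm.trans h6.symm) hpp
            · exact Or.inr h6
        obtain ⟨k, hk, hkp, hkj⟩ := ih j hj (hj.trans hi) p hpj
        exact ⟨k, hk, hkp, h.ge_trans hkj (Or.inr hji)⟩
  have geNest : ∀ i < n, ∀ u, Ge R u (ord i) →
      P u ≤ P (ord i) ∧ P (ord i) + A (ord i) ≤ P u + A u := by
    rintro i hi u (rfl | hui)
    · exact ⟨le_rfl, le_rfl⟩
    · exact ⟨(nest i hi u hui).1.le, (nest i hi u hui).2⟩
  -- Incomparable elements have disjoint intervals. The later one is replaced by its parent until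
  -- that parent is above the other element or is the virtual root `n`; then the elements lie in
  -- different sibling subtrees. `N` bounds the later position.
  have disj : ∀ N, ∀ i < n, ∀ j < n, i < N → j < i → ¬ R (ord j) (ord i) →
      P (ord j) + A (ord j) ≤ P (ord i) ∨ P (ord i) + A (ord i) ≤ P (ord j) := by
    intro N
    induction N with
    | zero => intro i _ j _ hi; omega
    | succ N ih =>
      intro i hi j hj hiN hji hR
      have hRij : ¬ R (ord i) (ord j) := fun h1 => by
        have := (hs j hj).2.2 i hi h1
        omega
      have hijne : ord i ≠ ord j := fun h1 => by
        have := hinj (show i < n from hi) (show j < n from hj) h1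
        omega
      have sibling : (par (ord i) = n ∨ R (par (ord i)) (ord j)) →
          P (ord j) + A (ord j) ≤ P (ord i) ∨ P (ord i) + A (ord i) ≤ P (ord j) := by
        intro hcase
        -- The sibling of `i` whose subtree contains `j`; it differs from `i` because `i` is not `≽
        -- j`.
        obtain ⟨k, hk, hkp, hkj⟩ := branch j hj (par (ord i)) hcase
        have h1 := hI.start i hi
        have h2 := hI.start k hk
        have h3 := geNest j hj _ hkj
        rw [hkp] at h2
        rcases lt_trichotomy i k with h4 | rfl | h4
        · have := hoff.disjoint i k (Nat.zero_le _) h4 hk hkp.symm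
          omega
        · rcases hkj with h5 | h5
          · exact absurd h5 hijne
          · exact absurd h5 hRij
        · have := hoff.disjoint k i (Nat.zero_le _) h4 hi hkp
          omega
      rcases hp i hi with h4 | ⟨k, hk, h4⟩
      · exact sibling (Or.inl h4)
      · by_cases hkj : R (ord k) (ord j)
        · exact sibling (Or.inr (h4 ▸ hkj))
        have hki : R (ord k) (ord i) := ((hs i hi).2.1 _).2 ⟨hlt k (hk.trans hi), Or.inl h4⟩
        have h5 := nest i hi _ hki
        have hjk : ¬ R (ord j) (ord k) := fun h6 => hR (h.trans _ _ _ h6 hki)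
        rcases lt_trichotomy j k with h6 | rfl | h6
        · have := ih k (hk.trans hi) j hj (by omega) h6 hjk
          omega
        · exact absurd hki hR
        · have := ih j hj k (hk.trans hi) (by omega) h6 hkj
          omega
  obtain ⟨i, hi, rfl⟩ := exists_position hinj hlt hu
  obtain ⟨j, hj, rfl⟩ := exists_position hinj hlt hv
  have hAi := hA i hi
  have hAj := hA j hj
  rw [hI.finish i hi]
  constructor
  · intro hij
    have := nest j hj _ hij
    omega
  · rintro ⟨h1, h2⟩
    by_contra hR
    rcases lt_trichotomy i j with h3 | rfl | h3
    · have := disj (j + 1) j hj i hi (by omega) h3 hR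
      omega
    · omega
    · by_cases hR' : R (ord j) (ord i)
      · have := nest i hi _ hR'
        omega
      · have := disj (i + 1) i hi j hj (by omega) h3 hR'
        omega

end Intervals

/-! ### Execution of the linear passes before and after the main loop -/

section FinalLoops

variable {n : ℕ} {O : ℕ → ℕ → ℕ}

theorem initLoop {m : Mem} (h0 : m.reg 0 = n) (h3 : m.reg 3 = 0) (h10 : m.reg 10 = 1) :
    ∃ m', ((∀ x, x ≠ 3 → m'.reg x = m.reg x) ∧ m'.reg 3 = n ∧
      ∀ i < n, m'.arr 0 i = i ∧ m'.arr 2 i = n ∧ m'.arr 3 i = 1) ∧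
      ∀ k, Reaches O (n * (initBody.weight + 1) + 1) (.while (.lt 3 0) initBody :: k, m)
        (k, m') := by
  obtain ⟨m', hI, hr⟩ := while_reaches (O := O) (b := .lt 3 0) (p := initBody) (m := m)
    (by simp [initBody, block, Cmd.LoopFree])
    (fun j m' => (∀ x, x ≠ 3 → m'.reg x = m.reg x) ∧ m'.reg 3 = j ∧
      ∀ i < j, m'.arr 0 i = i ∧ m'.arr 2 i = n ∧ m'.arr 3 i = 1) n
    (by
      rintro j hj m' ⟨hreg, hr3, hA⟩
      have e0 := hreg 0 (by decide)
      have e10 := hreg 10 (by decide)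
      refine ⟨by simp [Test.eval, hr3, e0, h0]; omega, ?_⟩
      obtain ⟨f1, f2, f3, f4, f5⟩ := exec_initBody O m'
      refine ⟨fun x hx => (f2 x hx).trans (hreg x hx), by rw [f1, hr3], fun i hi => ?_⟩
      rw [f3, f4, f5, hr3, e0, e10, h0, h10]
      rcases Nat.lt_succ_iff_lt_or_eq.1 hi with h1 | rfl
      · simp only [Function.update_of_ne h1.ne]
        exact hA i h1
      · simp)
    (by
      rintro m' ⟨hreg, hr3, -⟩
      simp [Test.eval, hr3, hreg 0 (by decide), h0])
    ⟨fun _ _ => rfl, h3, fun i hi => by omega⟩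
  exact ⟨m', hI, hr⟩

theorem offsetLoop {m : Mem} (h3 : m.reg 3 = n) (h10 : m.reg 10 = 1) (h14 : m.reg 14 = 0)
    (h15 : m.reg 15 = n + 1) (hinj : Set.InjOn (m.arr 0) (Set.Iio n))
    (hlt : ∀ i < n, m.arr 0 i < n) (hp : ParentsFirst n (m.arr 0) (m.arr 2))
    (hA : ∀ i ≤ n, m.arr 3 i = 1) :
    ∃ m', ((∀ x ∈ ([0, 10, 14, 15] : List ℕ), m'.reg x = m.reg x) ∧ m'.reg 3 = 0 ∧
      (∀ a, a ≠ 3 → a ≠ 4 → m'.arr a = m.arr a) ∧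
      Offsets n (m.arr 0) (m.arr 2) (m'.arr 3) (m'.arr 4) 0) ∧
      ∀ k, Reaches O (n * (offsetBody.weight + 1) + 1) (.while (.lt 14 3) offsetBody :: k, m)
        (k, m') := by
  obtain ⟨m', hI, hr⟩ := while_reaches (O := O) (b := .lt 14 3) (p := offsetBody) (m := m)
    (by simp [offsetBody, block, Cmd.LoopFree])
    (fun j m' => (∀ x ∈ ([0, 10, 14, 15] : List ℕ), m'.reg x = m.reg x) ∧ m'.reg 3 = n - j ∧
      (∀ a, a ≠ 3 → a ≠ 4 → m'.arr a = m.arr a) ∧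
      Offsets n (m.arr 0) (m.arr 2) (m'.arr 3) (m'.arr 4) (n - j)) n
    (by
      rintro j hj m' ⟨hreg, hr3, hA, hoff⟩
      have hreg' := hreg
      simp only [List.mem_cons, List.not_mem_nil, or_false, forall_eq_or_imp, forall_eq] at hreg
      obtain ⟨e0, e10, e14, e15⟩ := hreg
      refine ⟨by simp [Test.eval, hr3, e14, h14]; omega, ?_⟩
      obtain ⟨q, hq⟩ : ∃ q, n - j = q + 1 := ⟨n - j - 1, by omega⟩
      have hq' : n - (j + 1) = q := by omega
      rw [hq] at hoff hr3
      obtain ⟨g1, g2⟩ := hoff.step hinj hlt hp (by omega)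
      obtain ⟨f1, f2, f3, f4, f5⟩ := exec_offsetBody O m' (v := m.arr 0 q)
        (p := m.arr 2 (m.arr 0 q)) (e10.trans h10) hr3
        (by rw [hA 0 (by decide) (by decide)]) (by rw [hA 2 (by decide) (by decide)])
        (by rw [e15, h15]; exact g1)
      rw [hq', f4, f5]
      exact ⟨fun x hx => (f2 x hx).trans (hreg' x hx), f1,
        fun a h3 h4 => (f3 a h3 h4).trans (hA a h3 h4), g2⟩)
    (by
      rintro m' ⟨hreg, hr3, -⟩
      have e14 := hreg 14 (by simp)
      simp [Test.eval, hr3, e14, h14])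
    ⟨fun _ _ => rfl, h3, fun _ _ _ => rfl,
      ⟨fun u hu => (hA u hu).ge, fun i h1 h2 => by omega, fun i j h1 h2 h4 => by omega, by
        rw [Finset.sum_congr rfl (g := fun _ => 1)]
        · rw [Finset.sum_const, smul_eq_mul, mul_one]
          refine (Finset.card_insert_le _ _).trans (Nat.succ_le_succ ?_)
          exact Finset.card_image_le.trans (by simp)
        · intro u hu
          rw [Finset.mem_insert, Finset.mem_image] at hu
          rcases hu with rfl | ⟨i, hi, rfl⟩
          · exact hA _ le_rfl
          · exact hA _ (hlt i (by simpa using hi)).le⟩⟩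
  refine ⟨m', ?_, hr⟩
  simpa using hI

theorem intervalLoop {m : Mem} {ord par A F : ℕ → ℕ} (h0 : m.reg 0 = n) (h3 : m.reg 3 = 0)
    (h15 : m.reg 15 = n + 1) (hord : m.arr 0 = ord) (hpar : m.arr 2 = par) (hA : m.arr 3 = A)
    (hF : m.arr 4 = F) (hroot : m.arr 5 n = 0)
    (hinj : Set.InjOn ord (Set.Iio n))
    (hlt : ∀ i < n, ord i < n) (hp : ParentsFirst n ord par)
    (hoff : Offsets n ord par A F 0) :
    ∃ m', Intervals n ord par A F (m'.arr 5) (m'.arr 6) n ∧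
      ∀ k, Reaches O (n * (intervalBody.weight + 1) + 1) (.while (.lt 3 0) intervalBody :: k, m)
        (k, m') := by
  obtain ⟨m', hI, hr⟩ := while_reaches (O := O) (b := .lt 3 0) (p := intervalBody) (m := m)
    (by simp [intervalBody, block, Cmd.LoopFree])
    (fun j m' => (∀ x ∈ ([0, 10, 14, 15] : List ℕ), m'.reg x = m.reg x) ∧ m'.reg 3 = j ∧
      (∀ a, a ≠ 5 → a ≠ 6 → m'.arr a = m.arr a) ∧
      Intervals n ord par A F (m'.arr 5) (m'.arr 6) j) n
    (by
      rintro j hj m' ⟨hreg, hr3, hA', hI⟩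
      have hreg' := hreg
      simp only [List.mem_cons, List.not_mem_nil, or_false, forall_eq_or_imp, forall_eq] at hreg
      obtain ⟨e0, e10, e14, e15⟩ := hreg
      refine ⟨by simp [Test.eval, hr3, e0, h0]; omega, ?_⟩
      have a0 := (hA' 0 (by decide) (by decide)).trans hord
      have a2 := (hA' 2 (by decide) (by decide)).trans hpar
      have a3 := (hA' 3 (by decide) (by decide)).trans hA
      have a4 := (hA' 4 (by decide) (by decide)).trans hF
      obtain ⟨g1, g2⟩ := hI.step hoff hinj hlt hp hj
      obtain ⟨f1, f2, f3, f4, f5⟩ := exec_intervalBody O m' (v := ord j)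
        (p := par (ord j)) (by rw [hr3, a0]) (by rw [a2])
        (by rw [e15, h15, a3, a4]; exact g1)
      rw [a3, a4] at f5
      rw [a4] at f4
      rw [f4, f5]
      exact ⟨fun x hx => (f2 x hx).trans (hreg' x hx), by rw [f1, hr3],
        fun a h3 h4 => (f3 a h3 h4).trans (hA' a h3 h4), g2⟩)
    (by
      rintro m' ⟨hreg, hr3, -⟩
      have e0 := hreg 0 (by simp)
      simp [Test.eval, hr3, e0, h0])
    ⟨fun _ _ => rfl, h3, fun _ _ _ => rfl,
      ⟨hroot, fun i hi => by omega, fun i hi => by omega, fun i hi => by omega⟩⟩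
  exact ⟨m', hI.2.2.2, hr⟩

end FinalLoops

/-! ### The main loop -/

/-- The part of the program that cuts a segment, given the element `x` in the register `4` and the
element `y` in the register `5`. -/
def cutCmd : Cmd := block [block [.copy 6 4, .copy 3 1], .while (.lt 3 2) topBody,
  block [.load 7 2 6, .copy 3 1], .while (.lt 3 2) parentBody,
  block [.copy 3 1, .copy 11 1], .while (.lt 3 2) cutBody,
  block [.store 1 1 11, .store 1 11 2]]

/-- The part of the program that finds the elements `x` and `y` at the places that are given by the
random numbers, and their comparison. -/
def chooseCmd : Cmd := block [.sub 12 2 10, .sub 4 12 4, .sub 5 12 5, .load 4 0 4, .load 5 0 5,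
  geq 9 4 5]

/-- The body of the main loop. -/
def iteration : Cmd := block [block [.load 2 1 1, .sub 13 2 1, .sub 13 13 10],
  .ite (.lt 13 10) (.copy 1 2)
    (block [.rand 4 13, .rand 5 13, chooseCmd, .ite (.eq 9 10) .skip cutCmd])]

/-- The first part of the sorting program. -/
def initCmd : Cmd := block [block [.const 10 1, .const 3 0], .while (.lt 3 0) initBody,
  block [.store 3 0 10, .const 1 0, .store 1 1 0]]

/-- The last part of the sorting program. -/
def finalCmd : Cmd := block [block [.copy 3 0, .const 14 0, .succ 15 0],
  .while (.lt 14 3) offsetBody, block [.store 5 0 14, .const 3 0],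
  .while (.lt 3 0) intervalBody]

/-- The sorting program. -/
def sorter : Cmd := block [initCmd, .while (.lt 1 0) iteration, finalCmd]

/-- The answering program. -/
def answerer : Cmd := block [.load 2 5 0, .load 3 6 0, .load 4 5 1, .load 5 6 1,
  .ite (.lt 2 4) (.ite (.lt 4 3) (.const 0 1) (.const 0 0))
    (.ite (.lt 4 2) (.ite (.lt 2 5) (.const 0 2) (.const 0 0)) (.const 0 0))]

theorem Reaches.block_cons {O : ℕ → ℕ → ℕ} {T : ℕ} {p : Cmd} {l : List Cmd} {k : List Cmd}
    {m : Mem} {c : Config} (h : Reaches O T (p :: block l :: k, m) c) :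
    Reaches O (1 + T) (block (p :: l) :: k, m) c :=
  Reaches.head (by simp [block, step]) h

theorem Reaches.block_nil {O : ℕ → ℕ → ℕ} {k : List Cmd} {m : Mem} :
    Reaches O 1 (block [] :: k, m) (k, m) := Reaches.one (by simp [block, step])

/-- The state of the main loop: the segments of positions from `a` on have the ends `L`. -/
structure MainInv (R : ℕ → ℕ → Prop) (n : ℕ) (s : ℕ × List ℕ) (m : Mem) : Prop where
  reg0 : m.reg 0 = n
  reg1 : m.reg 1 = s.1
  reg10 : m.reg 10 = 1
  inj : Set.InjOn (m.arr 0) (Set.Iio n)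
  lt : ∀ i < n, m.arr 0 i < n
  ones : ∀ i ≤ n, m.arr 3 i = 1
  segs : Segs R n (m.arr 0) (m.arr 2) (m.arr 1) s.1 s.2
  settled : Settled R n (m.arr 0) (m.arr 2) s.1

/-- The potential of the segments from the position `a` on with the ends `L`. -/
noncomputable def pot : ℕ → List ℕ → ℝ
  | _, [] => 0
  | a, b :: L => xlog (b - a) + pot b L

theorem pot_nonneg (L : List ℕ) : ∀ a, 0 ≤ pot a L := by
  induction L with
  | nil => intro a; exact le_rfl
  | cons b L ih => intro a; exact add_nonneg (xlog_nonneg _) (ih b)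

/-! ### One round: correctness and worst-case time of a cut -/

section Main

variable {R : ℕ → ℕ → Prop} {n : ℕ} {O : ℕ → ℕ → ℕ}

theorem cutCmd_spec (h : IsForest R) (hn : ∀ u v, R u v → u < n ∧ v < n)
    (hO : ∀ i j, O i j = 1 ↔ R i j) {m : Mem} {a b : ℕ} {L : List ℕ}
    (hm : MainInv R n (a, b :: L) m) (h2 : m.reg 2 = b)
    (hx : m.reg 4 ∈ seg (m.arr 0) a b) (hy : m.reg 5 ∈ seg (m.arr 0) a b)
    (hxy : ¬ Ge R (m.reg 4) (m.reg 5)) :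
    ∃ m' L', MainInv R n (a, L') m' ∧
      pot a L' = xlog (cutSet R (seg (m.arr 0) a b) (m.reg 4) (m.reg 5)).card +
        xlog (b - a - (cutSet R (seg (m.arr 0) a b) (m.reg 4) (m.reg 5)).card) + pot b L ∧
      ∀ k, Reaches O ((b - a) * 100 + 100) (cutCmd :: k, m) (k, m') := by
  have hab : a ≤ b := hm.segs.1.1.le
  have hbn : b ≤ n := hm.segs.2.1.1
  set S := seg (m.arr 0) a b with hS
  have r1 := hm.reg1
  have r10 := hm.reg10
  have r0 := hm.reg0
  obtain ⟨m1, hm1⟩ : ∃ m1, (block [.copy 6 4, .copy 3 1]).exec O m = m1 := ⟨_, rfl⟩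
  have e1 : m1.arr = m.arr ∧ m1.reg 0 = n ∧ m1.reg 1 = a ∧ m1.reg 2 = b ∧ m1.reg 3 = a ∧
      m1.reg 5 = m.reg 5 ∧ m1.reg 6 = m.reg 4 ∧ m1.reg 10 = 1 := by
    subst hm1
    simp [block, Cmd.exec, Mem.setReg, r1, r10, h2, r0]
  obtain ⟨a1, b0, b1, b2, b3, b5, b6, b10⟩ := e1
  obtain ⟨m2, ⟨a2, c, z1, z2, z3, z4⟩, hr2⟩ := topLoop (O := O) h hO hab b2 b3 b10
    (by rw [a1, b6]; exact hx) (by rw [b5, b6]; exact hxy)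
  simp only [List.mem_cons, List.not_mem_nil, or_false, forall_eq_or_imp, forall_eq] at c
  obtain ⟨c0, c1, c2, c5, c10⟩ := c
  rw [a1, ← hS, b5, b6] at z4
  rw [b5] at z3
  rw [b6] at z2
  rw [a1] at z1
  obtain ⟨m3, hm3⟩ : ∃ m3, (block [.load 7 2 6, .copy 3 1]).exec O m2 = m3 := ⟨_, rfl⟩
  have e3 : m3.arr = m.arr ∧ m3.reg 0 = n ∧ m3.reg 1 = a ∧ m3.reg 2 = b ∧ m3.reg 3 = a ∧
      m3.reg 6 = m2.reg 6 ∧ m3.reg 7 = m.arr 2 (m2.reg 6) ∧ m3.reg 10 = 1 := by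
    subst hm3
    simp [block, Cmd.exec, Mem.setReg, a2, a1, c0, c1, c2, c10, b0, b1,
      b2, b10]
  obtain ⟨a3, d0, d1, d2, d3, d6, d7, d10⟩ := e3
  set z := m2.reg 6 with hz
  obtain ⟨m4, ⟨a4, g, hw⟩, hr4⟩ := parentLoop (O := O) h hn hO hab d2 d3 d10
    (by rw [a3, d6]; exact z1) (by rw [a3]; exact hm.segs.2.1.2.1) (by rw [d7, a3, d6])
  simp only [List.mem_cons, List.not_mem_nil, or_false, forall_eq_or_imp, forall_eq] at g
  obtain ⟨g0, g1, g2, g6, g10⟩ := g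
  rw [a3, d6, ← hS] at hw
  obtain ⟨m5, hm5⟩ : ∃ m5, (block [.copy 3 1, .copy 11 1]).exec O m4 = m5 := ⟨_, rfl⟩
  have e5 : m5.arr = m.arr ∧ m5.reg 0 = n ∧ m5.reg 1 = a ∧ m5.reg 2 = b ∧ m5.reg 3 = a ∧
      m5.reg 6 = z ∧ m5.reg 7 = m4.reg 7 ∧ m5.reg 10 = 1 ∧ m5.reg 11 = a := by
    subst hm5
    simp [block, Cmd.exec, Mem.setReg, a4, a3, g0, g1, g2, g6, g10, d0, d1,
      d2, d6, d10]
  obtain ⟨a5, f0, f1, f2, f3, f6, f7, f10, f11⟩ := e5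
  obtain ⟨m6, ⟨q, qa, π, p1, p2, p3, p4, p5, p6, p7, p8⟩, hr6⟩ :=
    cutLoop (R := R) (O := O) hO hab f2 f3 f10 f11
  simp only [List.mem_cons, List.not_mem_nil, or_false, forall_eq_or_imp, forall_eq] at q
  obtain ⟨q0, q1, q2, q6, q7, q10⟩ := q
  rw [a5] at p2 qa
  rw [a5, f6] at p5 p6 p7 p8
  rw [f7] at p7
  obtain ⟨⟨k1, k2⟩, k3, k4, k5, k6⟩ := segs_cut h hn hm.inj hm.segs hm.settled z1 ⟨_, hy, z3⟩ hw
    p1 p3 p4 p5 p6 p7 p8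
  obtain ⟨m7, hm7⟩ : ∃ m7, (block [.store 1 1 11, .store 1 11 2]).exec O m6 = m7 := ⟨_, rfl⟩
  have e7 : m7.reg = m6.reg ∧ (∀ i, i ≠ 1 → m7.arr i = m6.arr i) ∧ m7.arr 1 =
      Function.update (Function.update (m.arr 1) a (m6.reg 11)) (m6.reg 11) b := by
    subst hm7
    refine ⟨by simp [block, Cmd.exec, Mem.setArr], fun i hi => by
      simp [block, Cmd.exec, Mem.setArr, hi], ?_⟩
    have := qa 1 (by decide) (by decide)
    simp [block, Cmd.exec, Mem.setArr, q1, f1, q2, f2, this]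
  obtain ⟨s1, s2, s3⟩ := e7
  have t0 : m7.arr 0 = fun k => m.arr 0 (π k) := (s2 0 (by decide)).trans p2
  have t2 : m7.arr 2 = m6.arr 2 := s2 2 (by decide)
  have t3 : m7.arr 3 = m.arr 3 := (s2 3 (by decide)).trans (qa 3 (by decide) (by decide))
  -- The `z` found by the first scan realizes the cut of the probabilistic analysis.
  have hcut : cutSet R S (m.reg 4) (m.reg 5) = down R S z := cutSet_eq_down h z1 z2 z3 z4
  refine ⟨m7, m6.reg 11 :: b :: L, ⟨?_, ?_, ?_, ?_, ?_, ?_, ?_, ?_⟩, ?_, fun k => ?_⟩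
  · rw [s1, q0, f0]
  · rw [s1, q1, f1]
  · rw [s1, q10, f10]
  · rw [t0]; exact k3
  · rw [t0]; exact fun i hi => hm.lt _ (k4 i hi)
  · rw [t3]; exact hm.ones
  · rw [t0, t2, s3]; exact k5
  · rw [t0, t2]; exact k6
  · rw [hcut, pot, pot, k1, k2]; ring
  · have w1 : topBody.weight = 21 := rfl
    have w2 : parentBody.weight = 17 := rfl
    have w3 : cutBody.weight = 21 := rfl
    rw [w1] at hr2
    rw [w2] at hr4
    rw [w3] at hr6
    apply Reaches.mono
    · apply Reaches.block_cons
      apply Reaches.trans (reaches_exec _ (by simp [block, Cmd.LoopFree]) _ _)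
      rw [hm1]
      apply Reaches.block_cons
      apply Reaches.trans (hr2 _)
      apply Reaches.block_cons
      apply Reaches.trans (reaches_exec _ (by simp [block, Cmd.LoopFree]) _ _)
      rw [hm3]
      apply Reaches.block_cons
      apply Reaches.trans (hr4 _)
      apply Reaches.block_cons
      apply Reaches.trans (reaches_exec _ (by simp [block, Cmd.LoopFree]) _ _)
      rw [hm5]
      apply Reaches.block_cons
      apply Reaches.trans (hr6 _)
      apply Reaches.block_cons
      apply Reaches.trans (reaches_exec _ (by simp [block, Cmd.LoopFree]) _ _)
      rw [hm7]
      exact Reaches.block_nil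
    · simp only [block, Cmd.weight]
      omega

end Main
-- One round: expected cost against the potential
section Main

variable {R : ℕ → ℕ → Prop} {n : ℕ} {O : ℕ → ℕ → ℕ} {φ : Mem → ENNReal}

theorem MainInv.congr {s : ℕ × List ℕ} {m m' : Mem} (hm : MainInv R n s m) (harr : m'.arr = m.arr)
    (h0 : m'.reg 0 = m.reg 0) (h1 : m'.reg 1 = m.reg 1) (h10 : m'.reg 10 = m.reg 10) :
    MainInv R n s m' :=
  ⟨h0.trans hm.reg0, h1.trans hm.reg1, h10.trans hm.reg10, harr ▸ hm.inj, harr ▸ hm.lt,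
    harr ▸ hm.ones, harr ▸ hm.segs, harr ▸ hm.settled⟩

/-- The random numbers are counted backwards from the last position `b - 1`, because subtraction is
available and addition is not; reflection leaves the uniform distribution unchanged. -/
theorem chooseCut_spec (h : IsForest R) (hn : ∀ u v, R u v → u < n ∧ v < n)
    (hO : ∀ i j, O i j = 1 ↔ R i j) {m : Mem} {a b : ℕ} {L : List ℕ}
    (hm : MainInv R n (a, b :: L) m) (h2 : m.reg 2 = b)
    (h4 : m.reg 4 < b - a) (h5 : m.reg 5 < b - a) :
    ∃ m' L', MainInv R n (a, L') m' ∧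
      pot a L' = xlog (cutSet R (seg (m.arr 0) a b) (m.arr 0 (b - 1 - m.reg 4))
          (m.arr 0 (b - 1 - m.reg 5))).card +
        xlog (b - a - (cutSet R (seg (m.arr 0) a b) (m.arr 0 (b - 1 - m.reg 4))
          (m.arr 0 (b - 1 - m.reg 5))).card) + pot b L ∧
      ∀ k, Reaches O ((b - a) * 100 + 150)
        (block [chooseCmd, .ite (.eq 9 10) .skip cutCmd] :: k, m) (k, m') := by
  have r10 := hm.reg10
  obtain ⟨m1, hm1⟩ : ∃ m1, chooseCmd.exec O m = m1 := ⟨_, rfl⟩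
  have e1 : m1.arr = m.arr ∧ m1.reg 0 = m.reg 0 ∧ m1.reg 1 = m.reg 1 ∧ m1.reg 2 = b ∧
      m1.reg 10 = m.reg 10 ∧ m1.reg 4 = m.arr 0 (b - 1 - m.reg 4) ∧
      m1.reg 5 = m.arr 0 (b - 1 - m.reg 5) ∧
      m1.reg 9 = geVal O (m.arr 0 (b - 1 - m.reg 4)) (m.arr 0 (b - 1 - m.reg 5)) := by
    subst hm1
    simp [chooseCmd, block, Cmd.exec, exec_geq, Mem.setReg, r10, h2]
  obtain ⟨a1, b0, b1, b2, b10, b4, b5, b9⟩ := e1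
  have hm' : MainInv R n (a, b :: L) m1 := hm.congr a1 b0 b1 b10
  set x := m.arr 0 (b - 1 - m.reg 4)
  set y := m.arr 0 (b - 1 - m.reg 5)
  have hx : x ∈ seg (m.arr 0) a b := mem_seg.2 ⟨_, ⟨by omega, by omega⟩, rfl⟩
  have hy : y ∈ seg (m.arr 0) a b := mem_seg.2 ⟨_, ⟨by omega, by omega⟩, rfl⟩
  have hlf : chooseCmd.LoopFree := by simp [chooseCmd, block, geq, Cmd.LoopFree]
  have w : chooseCmd.weight = 15 := rfl
  by_cases hxy : Ge R x y
  · refine ⟨m1, b :: L, hm', ?_, fun k => ?_⟩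
    · rw [cutSet_eq_empty h hxy]
      simp [pot, xlog]
    · apply Reaches.mono
      · apply Reaches.block_cons
        apply Reaches.trans (reaches_exec _ hlf _ _)
        rw [hm1]
        apply Reaches.block_cons
        apply Reaches.trans
        · refine Reaches.head (c1 := (.skip :: block [] :: k, m1)) ?_
            (Reaches.one (by simp [step]; rfl))
          rw [step, Test.eval, b9, b10, r10, (geVal_eq_one hO x y).2 hxy]
          simp
        · exact Reaches.block_nil
      · omega
  · obtain ⟨m', L', h6, h7, h8⟩ := cutCmd_spec (O := O) h hn hO hm' b2
      (by rw [b4, a1]; exact hx) (by rw [b5, a1]; exact hy) (by rwa [b4, b5])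
    rw [a1, b4, b5] at h7
    refine ⟨m', L', h6, h7, fun k => ?_⟩
    apply Reaches.mono
    · apply Reaches.block_cons
      apply Reaches.trans (reaches_exec _ hlf _ _)
      rw [hm1]
      apply Reaches.block_cons
      apply Reaches.trans
      · refine Reaches.head (c1 := (cutCmd :: block [] :: k, m1)) ?_ (h8 _)
        rw [step, Test.eval, b9, b10, r10]
        simp [(geVal_eq_one hO x y).not.2 hxy]
      · exact Reaches.block_nil
    · omega

theorem sum_seg {ord : ℕ → ℕ} {a b : ℕ} (hinj : Set.InjOn ord (Set.Iio n)) (hb : b ≤ n)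
    (f : ℕ → ℝ) :
    ∑ u ∈ Finset.range (b - a), f (ord (b - 1 - u)) = ∑ x ∈ seg ord a b, f x := by
  rw [seg, Finset.sum_image, Finset.sum_Ico_eq_sum_range,
    ← Finset.sum_range_reflect]
  · refine Finset.sum_congr rfl fun u hu => ?_
    rw [Finset.mem_range] at hu
    congr 2
    omega
  · intro i hi j hj hij
    rw [Finset.mem_coe, Finset.mem_Ico] at hi hj
    exact hinj (show i < n by omega) (show j < n by omega) hij

theorem sum_sum_affine (l : ℕ) (q : ℕ → ℕ → ℝ) (c p w : ℝ) :
    ∑ u ∈ Finset.range l, ∑ v ∈ Finset.range l, (c * (q u v + p) + w) =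
      c * (∑ u ∈ Finset.range l, ∑ v ∈ Finset.range l, q u v) + l ^ 2 * (c * p + w) := by
  simp only [Finset.sum_add_distrib, mul_add, ← Finset.mul_sum, Finset.sum_const,
    Finset.card_range, nsmul_eq_mul]
  ring

theorem inv_mul_sum_le {l : ℕ} (hl : 0 < l) {f : ℕ → ℕ → ENNReal} {g : ℕ → ℕ → ℝ} {G : ℝ}
    (hfg : ∀ u < l, ∀ v < l, f u v ≤ ENNReal.ofReal (g u v)) (hg : ∀ u v, 0 ≤ g u v)
    (hG : ∑ u ∈ Finset.range l, ∑ v ∈ Finset.range l, g u v ≤ l ^ 2 * G) (s : ENNReal) :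
    (l : ENNReal)⁻¹ * ∑ u ∈ Finset.range l, (s + (l : ENNReal)⁻¹ * ∑ v ∈ Finset.range l, f u v) ≤
      s + ENNReal.ofReal G := by
  have hl0 : (l : ENNReal) ≠ 0 := by exact_mod_cast hl.ne'
  have hlt : (l : ENNReal) ≠ ⊤ := ENNReal.natCast_ne_top l
  have h1 : ∑ u ∈ Finset.range l, ∑ v ∈ Finset.range l, f u v ≤
      (l : ENNReal) * (l * ENNReal.ofReal G) := by
    calc ∑ u ∈ Finset.range l, ∑ v ∈ Finset.range l, f u v
        ≤ ∑ u ∈ Finset.range l, ∑ v ∈ Finset.range l, ENNReal.ofReal (g u v) :=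
          Finset.sum_le_sum fun u hu => Finset.sum_le_sum fun v hv =>
            hfg u (Finset.mem_range.1 hu) v (Finset.mem_range.1 hv)
      _ = ENNReal.ofReal (∑ u ∈ Finset.range l, ∑ v ∈ Finset.range l, g u v) := by
          rw [ENNReal.ofReal_sum_of_nonneg fun u _ => Finset.sum_nonneg fun v _ => hg u v]
          exact Finset.sum_congr rfl fun u _ =>
            (ENNReal.ofReal_sum_of_nonneg fun v _ => hg u v).symm
      _ ≤ ENNReal.ofReal (l ^ 2 * G) := ENNReal.ofReal_le_ofReal hG
      _ = _ := by
          rw [ENNReal.ofReal_mul (by positivity), ENNReal.ofReal_pow (by positivity),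
            ENNReal.ofReal_natCast, sq, mul_assoc]
  rw [Finset.sum_add_distrib, Finset.sum_const, Finset.card_range, nsmul_eq_mul, mul_add,
    ← mul_assoc, ENNReal.inv_mul_cancel hl0 hlt, one_mul, ← Finset.mul_sum]
  gcongr
  rw [ENNReal.inv_mul_le_iff hl0 hlt, ENNReal.inv_mul_le_iff hl0 hlt]
  exact h1

/-- The value of the potential function in a state of the main loop. -/
noncomputable def value (n d : ℕ) (e : ℝ) (s : ℕ × List ℕ) : ENNReal :=
  ENNReal.ofReal (512 * 300 * d * pot s.1 s.2 + 300 * (n - s.1) + e)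

/-- On a segment of length `l ≥ 2`, the expected drop of `512 · 300 · d` times the potential is at
least `300 l`, and the round costs at most `100 l + 185`. On a segment of length 1 the term `300 (n
- a)` drops by 300 and pays for at most 31 steps. -/
theorem iteration_cost (h : IsForest R) (hn : ∀ u v, R u v → u < n ∧ v < n)
    (hO : ∀ i j, O i j = 1 ↔ R i j) {d : ℕ} (hd : DegreeLe R n d) {e : ℝ} (he : 0 ≤ e)
    {s : ℕ × List ℕ} {m : Mem} (hm : MainInv R n s m) (hs : s.1 < n) (N : ℕ) (k : List Cmd)
    (hk : ∀ s' m', MainInv R n s' m' → cost O φ N (k, m') ≤ value n d e s') :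
    1 + cost O φ N (iteration :: k, m) ≤ value n d e s := by
  obtain ⟨a, L⟩ := s
  cases L with
  | nil => exact absurd hm.segs (ne_of_lt hs)
  | cons b L =>
  obtain ⟨⟨hab, hea⟩, ⟨hbn, hcl, hord⟩, hL⟩ := hm.segs
  simp only at hab hea hs hbn
  have r0 := hm.reg0
  have r1 : m.reg 1 = a := hm.reg1
  have r10 := hm.reg10
  obtain ⟨m1, hm1⟩ : ∃ m1, (block [.load 2 1 1, .sub 13 2 1, .sub 13 13 10]).exec O m = m1 :=
    ⟨_, rfl⟩
  have e1 : m1.arr = m.arr ∧ m1.reg 0 = m.reg 0 ∧ m1.reg 1 = m.reg 1 ∧ m1.reg 2 = b ∧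
      m1.reg 10 = m.reg 10 ∧ m1.reg 13 = b - a - 1 := by
    subst hm1
    simp [block, Cmd.exec, Mem.setReg, r10, r1, hea]
  obtain ⟨a1, b0, b1, b2, b10, b13⟩ := e1
  have hm' : MainInv R n (a, b :: L) m1 := hm.congr a1 b0 b1 b10
  have hnab : (b : ℝ) ≤ n := Nat.cast_le.2 hbn
  have hd0 : (0 : ℝ) ≤ d := Nat.cast_nonneg d
  by_cases hlen : b = a + 1
  · obtain ⟨m2, hm2⟩ : ∃ m2, (Cmd.copy 1 2).exec O m1 = m2 := ⟨_, rfl⟩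
    have e2 : m2.arr = m.arr ∧ m2.reg 0 = m.reg 0 ∧ m2.reg 1 = b ∧ m2.reg 10 = m.reg 10 := by
      subst hm2
      simp [Cmd.exec, Mem.setReg, b0, b2, b10, a1]
    obtain ⟨a2, c0, c1, c10⟩ := e2
    have hinv : MainInv R n (b, L) m2 := by
      refine ⟨c0.trans r0, c1, c10.trans r10, a2 ▸ hm.inj, a2 ▸ hm.lt, a2 ▸ hm.ones, ?_, ?_⟩
      · rw [a2]; exact hL
      · rw [a2]
        subst hlen
        exact hm.settled.step h ⟨hbn, hcl, hord⟩
    have hr : Reaches O 30 (iteration :: k, m) (k, m2) := by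
      apply Reaches.mono
      · apply Reaches.block_cons
        apply Reaches.trans (reaches_exec _ (by simp [block, Cmd.LoopFree]) _ _)
        rw [hm1]
        apply Reaches.block_cons
        apply Reaches.trans
        · refine Reaches.head (c1 := (.copy 1 2 :: block [] :: k, m1)) ?_
            (reaches_exec _ (by simp [Cmd.LoopFree]) _ _)
          rw [step, Test.eval, b13, b10, r10]
          simp [hlen]
        · rw [hm2]
          exact Reaches.block_nil
      · simp [block, Cmd.weight]
    have hpot : pot a (b :: L) = pot b L := by
      rw [pot, hlen]
      simp [xlog]
    have hba : (b : ℝ) = a + 1 := by rw [hlen]; push_cast; ring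
    calc 1 + cost O φ N (iteration :: k, m) ≤ 1 + ((30 : ℕ) + value n d e (b, L)) := by
          gcongr
          refine (hr.cost_le N).trans ?_
          gcongr
          exact hk _ _ hinv
      _ = ENNReal.ofReal 31 + value n d e (b, L) := by
          rw [← add_assoc]
          congr 1
          norm_num
      _ ≤ value n d e (a, b :: L) := by
          have := pot_nonneg L b
          rw [value, value, ← ENNReal.ofReal_add (by norm_num)
            (by simp only; nlinarith [mul_nonneg hd0 this])]
          refine ENNReal.ofReal_le_ofReal ?_
          simp only [hpot, hba]
          linarith
  · set l := b - a with hl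
    have hl2 : 2 ≤ l := by omega
    set S := seg (m.arr 0) a b with hS
    have hScard : S.card = l := card_seg hm.inj hbn
    have hr : Reaches O 30 (iteration :: k, m) (.rand 4 13 :: block [.rand 5 13, chooseCmd,
        .ite (.eq 9 10) .skip cutCmd] :: block [] :: k, m1) := by
      apply Reaches.mono
      · apply Reaches.block_cons
        apply Reaches.trans (reaches_exec _ (by simp [block, Cmd.LoopFree]) _ _)
        rw [hm1]
        apply Reaches.block_cons
        refine Reaches.head (T := 1 + 0) (c1 := (block [.rand 4 13, .rand 5 13, chooseCmd,
          .ite (.eq 9 10) .skip cutCmd] :: block [] :: k, m1)) ?_ ?_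
        · have hlt : ¬ l - 1 < 1 := by omega
          rw [step, Test.eval, b13, b10, r10]
          simp only [hlt, decide_false, Bool.false_eq_true, if_false]
        · apply Reaches.block_cons
          exact Reaches.refl 0 _
      · simp [block, Cmd.weight]
    set K : ℕ → ℕ → ℕ := fun u v =>
      (cutSet R S (m.arr 0 (b - 1 - u)) (m.arr 0 (b - 1 - v))).card with hK
    set g : ℕ → ℕ → ℝ := fun u v => 512 * 300 * d * ((xlog (K u v) + xlog (l - K u v)) + pot b L) +
      (300 * (n - a) + e + (l * 100 + 151)) with hg
    have hna : (0 : ℝ) ≤ n - a := by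
      have : (a : ℝ) ≤ n := Nat.cast_le.2 hs.le
      linarith
    have hpotb := pot_nonneg L b
    have hg0 : ∀ u v, 0 ≤ g u v := by
      intro u v
      have h1 := xlog_nonneg (K u v)
      have h2 := xlog_nonneg (l - K u v)
      rw [hg]
      positivity
    have hf : ∀ u < l, ∀ v < l,
        cost O φ N (block [chooseCmd, .ite (.eq 9 10) .skip cutCmd] :: block [] :: k,
          (m1.setReg 4 u).setReg 5 v) ≤ ENNReal.ofReal (g u v) := by
      intro u hu v hv
      have hinv : MainInv R n (a, b :: L) ((m1.setReg 4 u).setReg 5 v) :=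
        hm'.congr (by simp [Mem.setReg]) (by simp [Mem.setReg]) (by simp [Mem.setReg])
          (by simp [Mem.setReg])
      obtain ⟨m', L', h6, h7, h8⟩ := chooseCut_spec (O := O) h hn hO hinv
        (by simp [Mem.setReg, b2]) (by simpa [Mem.setReg] using hu)
        (by simpa [Mem.setReg] using hv)
      have e4 : ((m1.setReg 4 u).setReg 5 v).reg 4 = u := by simp [Mem.setReg]
      have e5 : ((m1.setReg 4 u).setReg 5 v).reg 5 = v := by simp [Mem.setReg]
      have ea : ((m1.setReg 4 u).setReg 5 v).arr = m.arr := by simp [Mem.setReg, a1]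
      rw [e4, e5, ea] at h7
      refine (((h8 _).trans Reaches.block_nil).cost_le N).trans ?_
      refine (add_le_add le_rfl (hk _ _ h6)).trans ?_
      rw [value, ← ENNReal.ofReal_natCast, ← ENNReal.ofReal_add (by positivity)]
      · refine ENNReal.ofReal_le_ofReal (le_of_eq ?_)
        simp only [h7, hg, hK]
        push_cast
        ring
      · have := pot_nonneg L' a
        simp only
        positivity
    -- This is `expected_xlog` multiplied by 300, with pairs of random numbers translated into pairs
    -- of elements; the other segments contribute a constant.
    have hsum : ∑ u ∈ Finset.range l, ∑ v ∈ Finset.range l, g u v ≤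
        l ^ 2 * (512 * 300 * d * pot a (b :: L) + 300 * (n - a) + e - 300 * l +
          (l * 100 + 151)) := by
      have h1 := expected_xlog h (S := S) (d := d) (by omega)
        (hcl.tops_le h hn hd fun v hv => by
          obtain ⟨i, hi, rfl⟩ := mem_seg.1 hv
          exact hm.lt i (by omega))
        (fun c hc B hB => hcl.tops_below_le h hd hc hB)
      rw [hScard] at h1
      have h2 : ∑ u ∈ Finset.range l, ∑ v ∈ Finset.range l, (xlog (K u v) + xlog (l - K u v)) =
          ∑ x ∈ S, ∑ y ∈ S, (xlog (cutSet R S x y).card +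
            xlog (l - (cutSet R S x y).card)) := by
        rw [← sum_seg hm.inj hbn]
        refine Finset.sum_congr rfl fun u _ => ?_
        rw [← sum_seg hm.inj hbn]
      rw [← h2] at h1
      simp only [hg]
      rw [sum_sum_affine, pot, ← hl]
      nlinarith
    have hl13 : m1.reg 13 + 1 = l := by rw [b13]; omega
    have hcost : cost O φ N (.rand 4 13 :: block [.rand 5 13, chooseCmd,
        .ite (.eq 9 10) .skip cutCmd] :: block [] :: k, m1) ≤
        1 + (2 + ENNReal.ofReal (512 * 300 * d * pot a (b :: L) + 300 * (n - a) + e - 300 * l +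
          (l * 100 + 151))) := by
      refine (cost_rand_le _ _ _ _ _).trans ?_
      rw [hl13]
      gcongr
      refine le_trans ?_ (inv_mul_sum_le (by omega) hf hg0 hsum 2)
      gcongr with u hu
      have h1 : Reaches O 1 (block [.rand 5 13, chooseCmd, .ite (.eq 9 10) .skip cutCmd] ::
          block [] :: k, m1.setReg 4 u) (.rand 5 13 :: block [chooseCmd,
          .ite (.eq 9 10) .skip cutCmd] :: block [] :: k, m1.setReg 4 u) :=
        (Reaches.block_cons (Reaches.refl 0 _)).mono (by omega)
      refine (h1.cost_le N).trans ?_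
      refine (add_le_add le_rfl (cost_rand_le _ _ _ _ _)).trans ?_
      have h13 : (m1.setReg 4 u).reg 13 + 1 = l := by simpa [Mem.setReg] using hl13
      rw [h13, ← add_assoc]
      gcongr
      norm_num
    have hl2' : (2 : ℝ) ≤ l := by exact_mod_cast hl2
    have hna' : (l : ℝ) ≤ n - a := by
      rw [hl, Nat.cast_sub hab.le]
      linarith
    have hX : 0 ≤ 512 * 300 * (d : ℝ) * pot a (b :: L) := by
      have := pot_nonneg (b :: L) a
      positivity
    calc 1 + cost O φ N (iteration :: k, m) ≤ 1 + ((30 : ℕ) + (1 + (2 +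
          ENNReal.ofReal (512 * 300 * d * pot a (b :: L) + 300 * (n - a) + e - 300 * l +
            (l * 100 + 151))))) := by
          gcongr
          refine (hr.cost_le N).trans ?_
          gcongr
      _ = ENNReal.ofReal 34 + ENNReal.ofReal (512 * 300 * d * pot a (b :: L) + 300 * (n - a) +
            e - 300 * l + (l * 100 + 151)) := by
          rw [← add_assoc, ← add_assoc, ← add_assoc]
          congr 1
          norm_num
      _ ≤ value n d e (a, b :: L) := by
          rw [value, ← ENNReal.ofReal_add (by norm_num) (by linarith)]
          refine ENNReal.ofReal_le_ofReal ?_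
          simp only
          linarith

end Main
/-! ### The whole program -/

section Whole

variable {R : ℕ → ℕ → Prop} {n : ℕ} {O : ℕ → ℕ → ℕ}

theorem initCmd_spec (hn : ∀ u v, R u v → u < n ∧ v < n) {m : Mem} (h0 : m.reg 0 = n) :
    ∃ m' L, MainInv R n (0, L) m' ∧ pot 0 L ≤ xlog n ∧
      ∀ k, Reaches O (n * 20 + 30) (initCmd :: k, m) (k, m') := by
  obtain ⟨m1, hm1⟩ : ∃ m1, (block [.const 10 1, .const 3 0]).exec O m = m1 := ⟨_, rfl⟩
  have e1 : m1.reg 0 = n ∧ m1.reg 3 = 0 ∧ m1.reg 10 = 1 := by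
    subst hm1
    simp [block, Cmd.exec, Mem.setReg, h0]
  obtain ⟨b0, b3, b10⟩ := e1
  obtain ⟨m2, ⟨c, c3, ca⟩, hr2⟩ := initLoop (O := O) b0 b3 b10
  obtain ⟨m3, hm3⟩ : ∃ m3, (block [.store 3 0 10, .const 1 0, .store 1 1 0]).exec O m2 = m3 :=
    ⟨_, rfl⟩
  have c0 : m2.reg 0 = n := (c 0 (by decide)).trans b0
  have c10 : m2.reg 10 = 1 := (c 10 (by decide)).trans b10
  have e3 : m3.reg 0 = n ∧ m3.reg 1 = 0 ∧ m3.reg 10 = 1 ∧ m3.arr 0 = m2.arr 0 ∧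
      m3.arr 2 = m2.arr 2 ∧ m3.arr 3 = Function.update (m2.arr 3) n 1 ∧ m3.arr 1 0 = n := by
    subst hm3
    simp [block, Cmd.exec, Mem.setReg, Mem.setArr, c0, c10]
  obtain ⟨d0, d1, d10, da0, da2, da3, da1⟩ := e3
  have hord : ∀ i < n, m3.arr 0 i = i := fun i hi => by rw [da0]; exact (ca i hi).1
  have hpar : ∀ i < n, m3.arr 2 i = n := fun i hi => by rw [da2]; exact (ca i hi).2.1
  have hinv : ∀ L, Segs R n (m3.arr 0) (m3.arr 2) (m3.arr 1) 0 L → MainInv R n (0, L) m3 := by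
    intro L hL
    refine ⟨d0, d1, d10, fun i hi j hj hij => ?_, fun i hi => by rwa [hord i hi],
      fun i hi => ?_, hL, fun i hi => absurd hi (Nat.not_lt_zero i)⟩
    · rwa [hord i hi, hord j hj] at hij
    · rw [da3, Function.update_apply]
      split_ifs with h1
      · rfl
      · exact (ca i (lt_of_le_of_ne hi h1)).2.2
  have hr : ∀ k, Reaches O (n * 20 + 30) (initCmd :: k, m) (k, m3) := by
    intro k
    have w : initBody.weight = 9 := rfl
    rw [w] at hr2
    apply Reaches.mono
    · apply Reaches.block_cons
      apply Reaches.trans (reaches_exec _ (by simp [block, Cmd.LoopFree]) _ _)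
      rw [hm1]
      apply Reaches.block_cons
      apply Reaches.trans (hr2 _)
      apply Reaches.block_cons
      apply Reaches.trans (reaches_exec _ (by simp [block, Cmd.LoopFree]) _ _)
      rw [hm3]
      exact Reaches.block_nil
    · simp only [block, Cmd.weight]
      omega
  rcases Nat.eq_zero_or_pos n with hn0 | hn0
  · exact ⟨m3, [], hinv [] hn0.symm, xlog_nonneg n, hr⟩
  · refine ⟨m3, [n], hinv [n] ⟨⟨hn0, da1⟩, ⟨le_rfl, ⟨n, le_rfl, fun v hv => ?_⟩,
      fun _ _ _ j hj _ => hj⟩, rfl⟩, by simp [pot], hr⟩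
    obtain ⟨i, hi, rfl⟩ := mem_seg.1 hv
    refine ⟨by rw [hord i hi.2, hpar i hi.2], fun u => ⟨fun hu => ?_, ?_⟩⟩
    · have hun := (hn _ _ hu).1
      exact Or.inl ⟨mem_seg.2 ⟨u, ⟨Nat.zero_le _, hun⟩, hord u hun⟩, hu⟩
    · rintro (⟨_, hu⟩ | ⟨hu, rfl | hu'⟩)
      · exact hu
      · exact absurd hu (lt_irrefl _)
      · exact absurd (hn _ _ hu').2 (lt_irrefl _)

theorem finalCmd_spec (h : IsForest R) (hn : ∀ u v, R u v → u < n ∧ v < n) {m : Mem}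
    {L : List ℕ} {a : ℕ} (hm : MainInv R n (a, L) m) (ha : n ≤ a) :
    ∃ m', (∀ u < n, ∀ v < n, R u v ↔ m'.arr 5 u < m'.arr 5 v ∧ m'.arr 5 v < m'.arr 6 u) ∧
      ∀ k, Reaches O (n * 70 + 50) (finalCmd :: k, m) (k, m') := by
  have r0 := hm.reg0
  have r10 := hm.reg10
  have hset : Settled R n (m.arr 0) (m.arr 2) n := fun i hi => hm.settled i (hi.trans_le ha)
  obtain ⟨m1, hm1⟩ : ∃ m1, (block [.copy 3 0, .const 14 0, .succ 15 0]).exec O m = m1 := ⟨_, rfl⟩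
  have e1 : m1.arr = m.arr ∧ m1.reg 0 = n ∧ m1.reg 3 = n ∧ m1.reg 10 = 1 ∧ m1.reg 14 = 0 ∧
      m1.reg 15 = n + 1 := by
    subst hm1
    simp [block, Cmd.exec, Mem.setReg, r0, r10]
  obtain ⟨a1, b0, b3, b10, b14, b15⟩ := e1
  have hp := hset.parentsFirst hm.inj hm.lt
  obtain ⟨m2, ⟨c, c3, ca, hoff⟩, hr2⟩ := offsetLoop (O := O) b3 b10 b14 b15
    (by rw [a1]; exact hm.inj) (by rw [a1]; exact hm.lt) (by rw [a1]; exact hp) (by rw [a1]; exact hm.ones)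
  rw [a1] at hoff ca
  simp only [List.mem_cons, List.not_mem_nil, or_false, forall_eq_or_imp, forall_eq] at c
  obtain ⟨c0, c10, c14, c15⟩ := c
  obtain ⟨m3, hm3⟩ : ∃ m3, (block [.store 5 0 14, .const 3 0]).exec O m2 = m3 := ⟨_, rfl⟩
  have e3 : m3.reg 0 = n ∧ m3.reg 3 = 0 ∧ m3.reg 15 = n + 1 ∧ m3.arr 5 n = 0 ∧
      ∀ i, i ≠ 5 → m3.arr i = m2.arr i := by
    subst hm3
    simp [block, Cmd.exec, Mem.setReg, Mem.setArr, c0, b0, c14, b14, c15, b15]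
    exact fun i hi => by simp [hi]
  obtain ⟨d0, d3, d15, d5, da⟩ := e3
  obtain ⟨m4, hI, hr4⟩ := intervalLoop (O := O) d0 d3 d15
    ((da 0 (by decide)).trans (ca 0 (by decide) (by decide)))
    ((da 2 (by decide)).trans (ca 2 (by decide) (by decide)))
    (da 3 (by decide)) (da 4 (by decide)) d5 hm.inj hm.lt hp hoff
  refine ⟨m4, fun u hu v hv => hI.correct h hn hoff hm.inj hm.lt hset hu hv, fun k => ?_⟩
  have w1 : offsetBody.weight = 21 := rfl
  have w2 : intervalBody.weight = 29 := rfl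
  rw [w1] at hr2
  rw [w2] at hr4
  apply Reaches.mono
  · apply Reaches.block_cons
    apply Reaches.trans (reaches_exec _ (by simp [block, Cmd.LoopFree]) _ _)
    rw [hm1]
    apply Reaches.block_cons
    apply Reaches.trans (hr2 _)
    apply Reaches.block_cons
    apply Reaches.trans (reaches_exec _ (by simp [block, Cmd.LoopFree]) _ _)
    rw [hm3]
    apply Reaches.block_cons
    apply Reaches.trans (hr4 _)
    exact Reaches.block_nil
  · simp only [block, Cmd.weight]
    omega

theorem sorter_cost (h : IsForest R) (hn : ∀ u v, R u v → u < n ∧ v < n)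
    (hO : ∀ i j, O i j = 1 ↔ R i j) {d : ℕ} (hd : DegreeLe R n d) {φ : Mem → ENNReal}
    (hφ : ∀ m : Mem, (∀ u < n, ∀ v < n,
      R u v ↔ m.arr 5 u < m.arr 5 v ∧ m.arr 5 v < m.arr 6 u) → φ m = 0)
    (N : ℕ) : cost O φ N (startConfig sorter n) ≤
      ENNReal.ofReal (153600 * d * xlog n + 400 * n + 100) := by
  -- A reserve in the potential that pays for the final passes.
  set e : ℝ := 70 * n + 60 with he
  have he0 : 0 ≤ e := by positivity
  obtain ⟨m1, L, hinv, hpot, hr⟩ := initCmd_spec (R := R) (O := O) hn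
    (m := { reg := fun x => if x = 0 then n else 0, arr := fun _ _ => 0 }) (by simp)
  have hstart : Reaches O (n * 20 + 32) (startConfig sorter n)
      (.while (.lt 1 0) iteration :: block [finalCmd] :: [], m1) := by
    apply Reaches.mono
    · apply Reaches.block_cons
      apply Reaches.trans (hr _)
      exact Reaches.block_cons (Reaches.refl 0 _)
    · omega
  have hloop := cost_while_le (O := O) (φ := φ) (b := .lt 1 0) (p := iteration)
    (k := [block [finalCmd]]) (MainInv R n) (value n d e) N
    (by
      rintro ⟨a, L⟩ m hm hb N' _
      have hna : n ≤ a := by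
        have h0 := hm.reg0
        have h1 := hm.reg1
        simpa [Test.eval, h0, h1] using hb
      have han : a ≤ n := by
        have hs := hm.segs
        cases L with
        | nil => exact le_of_eq hs
        | cons b L =>
          have h1 := hs.1.1
          have h2 := hs.2.1.1
          simp only at h1
          omega
      obtain ⟨m', hm', hr'⟩ := finalCmd_spec (O := O) h hn hm hna
      have hfin : Reaches O (n * 70 + 52) (block [finalCmd] :: [], m) ([], m') := by
        apply Reaches.mono
        · apply Reaches.block_cons
          apply Reaches.trans (hr' _)
          exact Reaches.block_nil
        · omega
      have hend : cost O φ N' ([], m') ≤ 0 := by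
        cases N' with
        | zero => simp [cost]
        | succ N' => simp [cost, hφ m' hm']
      calc 1 + cost O φ N' (block [finalCmd] :: [], m)
          ≤ 1 + ((n * 70 + 52 : ℕ) + 0) := by
            gcongr
            exact (hfin.cost_le N').trans (by gcongr)
        _ = ENNReal.ofReal ((n * 70 + 53 : ℕ) : ℝ) := by
            rw [ENNReal.ofReal_natCast]
            push_cast
            ring
        _ ≤ value n d e (a, L) := by
            rw [value]
            refine ENNReal.ofReal_le_ofReal ?_
            have h1 : (a : ℝ) ≤ n := Nat.cast_le.2 han
            have h2 := pot_nonneg L a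
            have h3 : 0 ≤ 512 * 300 * (d : ℝ) * pot a L := by positivity
            push_cast
            linarith)
    (by
      intro s m hm hb N' k' hk'
      have hlt : s.1 < n := by
        have h0 := hm.reg0
        have h1 := hm.reg1
        simpa [Test.eval, h0, h1] using hb
      exact iteration_cost h hn hO hd he0 hm hlt N' k' hk')
    (0, L) m1 hinv
  calc cost O φ N (startConfig sorter n) ≤ (n * 20 + 32 : ℕ) + value n d e (0, L) :=
        (hstart.cost_le N).trans (by gcongr)
    _ ≤ _ := by
        have h1 := pot_nonneg L 0
        have h2 := mul_le_mul_of_nonneg_left hpot (Nat.cast_nonneg (α := ℝ) d)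
        rw [value, ← ENNReal.ofReal_natCast, ← ENNReal.ofReal_add (by positivity)
          (by simp only [Nat.cast_zero, sub_zero]; positivity)]
        refine ENNReal.ofReal_le_ofReal ?_
        simp only [he]
        push_cast
        linarith

end Whole

/-! ### Tree posets as forests on the natural numbers -/

section Transfer

variable {n : ℕ} {r : Fin n → Fin n → Prop}

/-- The relation on the natural numbers that is given by a relation on `{0, …, n - 1}`. -/
def natRel (r : Fin n → Fin n → Prop) (i j : ℕ) : Prop :=
  ∃ (hi : i < n) (hj : j < n), r ⟨i, hi⟩ ⟨j, hj⟩

theorem natRel_lt (u v : ℕ) (h : natRel r u v) : u < n ∧ v < n := ⟨h.1, h.2.1⟩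

theorem natRel_fin (i j : Fin n) : natRel r i j ↔ r i j := by
  simp [natRel]

theorem oracle_eq_one (i j : ℕ) : oracle r i j = 1 ↔ natRel r i j := by
  unfold oracle natRel
  constructor
  · intro h
    split_ifs at h with h1 h2 h3
    · exact ⟨h1.1, h1.2, h2⟩
    all_goals simp at h
  · rintro ⟨hi, hj, h⟩
    rw [dif_pos ⟨hi, hj⟩, if_pos h]

/-- Of the well-ordering of ancestors only trichotomy is needed. -/
theorem IsTree.isForest (h : IsTree r) : IsForest (natRel r) := by
  have hs := h.strictOrder
  refine ⟨?_, ?_, ?_⟩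
  · rintro a ⟨h1, _, h2⟩
    exact irrefl_of r _ h2
  · rintro a b c ⟨ha, hb, hab⟩ ⟨_, hc, hbc⟩
    exact ⟨ha, hc, trans_of r hab hbc⟩
  · rintro a b t ⟨ha, ht, hat⟩ ⟨hb, _, hbt⟩
    have hw := h.wellOrdered ⟨t, ht⟩
    rcases trichotomous_of (fun a b : {s : Fin n // r s ⟨t, ht⟩} => r a.1 b.1)
      ⟨⟨a, ha⟩, hat⟩ ⟨⟨b, hb⟩, hbt⟩ with h1 | h1 | h1
    · exact Or.inr (Or.inl ⟨ha, hb, h1⟩)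
    · simp only [Subtype.mk.injEq, Fin.mk.injEq] at h1
      exact Or.inl h1
    · exact Or.inr (Or.inr ⟨hb, ha, h1⟩)

theorem card_le_ncard_of_val {B : Finset ℕ} {X : Set (Fin n)}
    (h : ∀ v ∈ B, ∃ x ∈ X, (x : ℕ) = v) : B.card ≤ X.ncard := by
  rw [← Set.ncard_coe_finset]
  refine (Set.ncard_le_ncard (fun v hv => ?_) ((Set.toFinite X).image _)).trans
    (Set.ncard_image_le (f := Fin.val) (Set.toFinite X))
  obtain ⟨x, hx, hxv⟩ := h v hv
  exact ⟨x, hx, hxv⟩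

theorem degreeLe_maxDegree : DegreeLe (natRel r) n (maxDegree r) := by
  refine ⟨fun B hB => ?_, fun c B hB => ?_⟩
  · refine (card_le_ncard_of_val (X := maximals r) fun v hv => ?_).trans (le_max_left _ _)
    obtain ⟨h1, h2⟩ := hB v hv
    exact ⟨⟨v, h1⟩, fun y hy => h2 y ⟨y.2, h1, hy⟩, rfl⟩
  · rcases B.eq_empty_or_nonempty with rfl | ⟨v0, hv0⟩
    · simp
    obtain ⟨⟨hc, _, _⟩, _⟩ := hB v0 hv0
    refine (card_le_ncard_of_val (X := children r ⟨c, hc⟩) fun v hv => ?_).trans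
      ((Finset.le_sup (f := fun t => (children r t).ncard) (Finset.mem_univ _)).trans
        (le_max_right _ _))
    obtain ⟨⟨_, h1, h2⟩, h3⟩ := hB v hv
    exact ⟨⟨v, h1⟩, ⟨h2, fun z hz => h3 z ⟨⟨hc, z.2, hz.1⟩, ⟨z.2, h1, hz.2⟩⟩⟩, rfl⟩

theorem one_le_maxDegree (h : IsTree r) (hn : 0 < n) : 1 ≤ maxDegree r := by
  obtain ⟨b, hb, _⟩ := exists_top h.isForest (Finset.mem_range.2 hn)
  refine le_trans (Finset.card_pos.2 ⟨b, hb⟩) (degreeLe_maxDegree.roots _ fun v hv => ?_)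
  obtain ⟨h1, h2⟩ := mem_tops.1 hv
  exact ⟨Finset.mem_range.1 h1, fun u hu => h2 u (Finset.mem_range.2 hu.1) hu⟩

theorem represents_answerer (h : IsTree r) {m : Mem}
    (hm : ∀ u < n, ∀ v < n,
      natRel r u v ↔ m.arr 5 u < m.arr 5 v ∧ m.arr 5 v < m.arr 6 u) :
    Represents r answerer answerer.weight m := by
  intro i j c hc
  have hrun := (reaches_exec (O := fun _ _ => 0) answerer
    (by simp [answerer, block, Cmd.LoopFree]) [] ((m.setReg 0 i).setReg 1 j)).run_eq
  rw [answerConfig, hrun, PMF.support_pure, Set.mem_singleton_iff] at hc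
  subst hc
  refine ⟨rfl, ?_⟩
  have hij := hm i i.2 j j.2
  have hji := hm j j.2 i i.2
  rw [natRel_fin] at hij hji
  have hs := h.strictOrder
  have hor : oracle r i j = if m.arr 5 i < m.arr 5 j ∧ m.arr 5 j < m.arr 6 i then 1 else
      if m.arr 5 j < m.arr 5 i ∧ m.arr 5 i < m.arr 6 j then 2 else 0 := by
    classical
    simp only [oracle, i.2, j.2, and_self, dif_pos, Fin.eta, ← hij, ← hji]
  rw [hor]
  simp only [answerer, block, Cmd.exec, Test.eval, Mem.setReg, Function.update_apply]
  by_cases h1 : m.arr 5 i < m.arr 5 j <;> by_cases h2 : m.arr 5 j < m.arr 6 i <;>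
  by_cases h3 : m.arr 5 j < m.arr 5 i <;> by_cases h4 : m.arr 5 i < m.arr 6 j <;>
  first
  | (simp [h1, h2, h3, h4]; done)
  | omega

end Transfer

/-- Since `d ≥ 1` and `log n ≥ 1/2`, the surplus `1400 d n log n` is at least `700 n`, which covers
`400 n + 100`. -/
theorem cost_bound_le {n d : ℕ} (hn : 2 ≤ n) (hd : 1 ≤ d) :
    153600 * d * xlog n + 400 * n + 100 ≤ 155000 * d * n * Real.log n := by
  have h1 : (2 : ℝ) ≤ n := by exact_mod_cast hn
  have h2 : (1 : ℝ) ≤ d := by exact_mod_cast hd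
  have h3 : 1 / 2 ≤ Real.log n := by
    have h4 := Real.log_two_gt_d9
    have h5 := Real.log_le_log (by norm_num) h1
    linarith
  have h4 : (n : ℝ) * (1 / 2) ≤ d * (n * Real.log n) := by
    have h5 : (n : ℝ) * (1 / 2) ≤ n * Real.log n := by gcongr
    nlinarith
  unfold xlog
  nlinarith

end TreeSort

theorem theorem1 :
    ∃ (P Q : TreeSort.Cmd) (K : ℕ) (C : ℝ), Q.OracleFree ∧
      ∀ (n : ℕ) (r : Fin n → Fin n → Prop), TreeSort.IsTree r →
        TreeSort.Sorts r P Q K ∧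
        (2 ≤ n →
          TreeSort.expectedQueries (TreeSort.oracle r) (TreeSort.startConfig P n) ≤
              ENNReal.ofReal (C * TreeSort.maxDegree r * n * Real.log n) ∧
          TreeSort.expectedTime (TreeSort.oracle r) (TreeSort.startConfig P n) ≤
              ENNReal.ofReal (C * TreeSort.maxDegree r * n * Real.log n)) := by
  refine ⟨TreeSort.sorter, TreeSort.answerer, TreeSort.answerer.weight, 155000,
    by simp [TreeSort.answerer, TreeSort.block, TreeSort.Cmd.OracleFree], fun n r hr => ?_⟩
  classical
  -- The infinite reward on memories that do not represent `r` makes this one bound carry both the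
  -- time estimate and the correctness of every output.
  have hcost := fun N => TreeSort.sorter_cost hr.isForest TreeSort.natRel_lt
    TreeSort.oracle_eq_one TreeSort.degreeLe_maxDegree
    (φ := fun m => if TreeSort.Represents r TreeSort.answerer TreeSort.answerer.weight m
      then 0 else ⊤)
    (fun m hm => if_pos (TreeSort.represents_answerer hr hm)) N
  have htime := TreeSort.expectedTime_le hcost
  refine ⟨⟨htime.trans_lt ENNReal.ofReal_lt_top, fun t c hc hh => ?_⟩, fun hn => ?_⟩
  · have h1 := TreeSort.reward_ne_top t _ ((hcost (t + 1)).trans_lt ENNReal.ofReal_lt_top).ne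
      c hc hh
    by_contra hcon
    exact h1 (if_neg hcon)
  · have h1 := htime.trans (ENNReal.ofReal_le_ofReal
      (TreeSort.cost_bound_le hn (TreeSort.one_le_maxDegree hr (by omega))))
    exact ⟨(TreeSort.expectedQueries_le_expectedTime _).trans h1, h1⟩
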